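/- Let $\mathbb K$ be a field of characteristic $0$ and $d\ge 0$. For $n\ge 0$ let $X_n$ be the disjoint union of $n$ oriented arcs. A Jacobi diagram on $X_n$ is a finite vertex-oriented uni-trivalent graph, each of whose connected components has at least one univalent vertex, with its univalent vertices embedded in the interior of $X_n$ (up to isomorphism of such data and isotopy of $X_n$); its degree is half the number of its vertices. Let $A_d(n)$ be the $\mathbb K$-vector space spanned by the Jacobi diagrams of degree $d$ on $X_n$ modulo the STU relations, filtered by the subspaces $A_{d,k}(n)$ spanned by the diagrams with at least $k$ trivalent vertices. Let $F_n=\langle x_1,\dots,x_n\rangle$ be the free group, $\mathbf F$ the category of the groups $F_n$ $(n\ge0)$ and all group homomorphisms, and $A_d:\mathbf F^{\mathrm{op}}\to \mathbf{fVect}_{\mathbb K}$ the following functor to filtered vector spaces. A homomorphism $f:F_n\to F_m$ is viewed as a homotopy class of $n$ arcs in the genus $m$ handlebody, the $j$-th arc running through the handles according to a word for $f(x_j)$, with the last letter of the word passed first. For a Jacobi diagram $D$ on $X_m$, $A_d(f)(D)$ is obtained by composing these arcs with $D$: it is the sum over all ways of moving each univalent vertex of $D$ on the $i$-th arc to one of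 the passages of the new arcs through the $i$-th handle, keeping the order of the univalent vertices on positive passages, reversing it on negative passages, and with a factor $-1$ for each univalent vertex on a negative passage. The group $\mathrm{Aut}(F_n)$ acts on $A_d(n)$ from the right by $u\cdot g=A_d(g)(u)$. Then, for every $n\ge 0$, the subgroup $\mathrm{Inn}(F_n)$ of inner automorphisms $x\mapsto axa^{-1}$ acts trivially on $A_d(n)$. Therefore the $\mathrm{Aut}(F_n)$-action on $A_d(n)$ induces a (unique) right action of the outer automorphism group $\mathrm{Out}(F_n)=\mathrm{Aut}(F_n)/\mathrm{Inn}(F_n)$ on the filtered vector space $A_d(n)$, for which the class of $g\in\mathrm{Aut}(F_n)$ acts as $g$. Thus $A_d$ is an outer functor, that is, a functor on $\mathbf F^{\mathrm{op}}$ with values in $\mathbb K$-vector spaces (after forgetting the filtrations) for which all inner automorphisms of all the groups $F_n$ act trivially. -/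

import Mathlib

open CategoryTheory

universe u v

namespace Jacobi

/-! ## Jacobi diagrams on `n` oriented arcs -/

/-- The half-edges of a graph with set `Leg` of univalent vertices and set `Tri` of trivalent
vertices: one half-edge `inl l` at each univalent vertex `l`, and three half-edges
`inr (t, 0), inr (t, 1), inr (t, 2)` at each trivalent vertex `t`. -/
abbrev HalfEdge (Leg Tri : Type) : Type := Leg ⊕ (Tri × Fin 3)

/-- Two half-edges are linked if they form an edge or sit at the same trivalent vertex. -/
inductive Linked {Leg Tri : Type} (pair : HalfEdge Leg Tri → HalfEdge Leg Tri) :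
    HalfEdge Leg Tri → HalfEdge Leg Tri → Prop
  | edge (h : HalfEdge Leg Tri) : Linked pair h (pair h)
  | vertex (t : Tri) (i j : Fin 3) : Linked pair (Sum.inr (t, i)) (Sum.inr (t, j))

/-- A finite vertex-oriented uni-trivalent graph (multiple edges and self-loops are allowed) each
of whose connected components has at least one univalent vertex. The fixed-point free involution
`pair` matches the two half-edges of every edge. The orientation of a trivalent vertex `t` is the
cyclic order `(t, 0), (t, 1), (t, 2)` of its half-edges. -/
structure UniTriGraph where
  Leg : Type
  Tri : Type
  [fintypeLeg : Fintype Leg]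
  [fintypeTri : Fintype Tri]
  pair : HalfEdge Leg Tri → HalfEdge Leg Tri
  pair_pair : ∀ h, pair (pair h) = h
  pair_ne : ∀ h, pair h ≠ h
  exists_leg : ∀ h, ∃ l : Leg, Relation.EqvGen (Linked pair) h (Sum.inl l)

attribute [instance] UniTriGraph.fintypeLeg UniTriGraph.fintypeTri

/-- An embedding, up to isotopy, of the finite set `Λ` into the interior of `X_n`, the disjoint
union of `n` oriented arcs: each point `x` lies on the arc `arc x`, and `before x y` says that `x`
and `y` lie on the same arc and that `x` comes before `y` with respect to its orientation. -/
@[ext]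
structure Attachment (n : ℕ) (Λ : Type) where
  arc : Λ → Fin n
  before : Λ → Λ → Prop
  arc_eq : ∀ {x y}, before x y → arc x = arc y
  irrefl : ∀ x, ¬ before x x
  trans : ∀ {x y z}, before x y → before y z → before x z
  total : ∀ {x y}, arc x = arc y → x ≠ y → before x y ∨ before y x

/-- A Jacobi diagram on `X_n`. -/
structure JacobiDiagram (n : ℕ) where
  graph : UniTriGraph
  att : Attachment n graph.Leg

/-- The number of trivalent vertices. -/
def JacobiDiagram.numTrivalent {n : ℕ} (D : JacobiDiagram n) : ℕ := Fintype.card D.graph.Tri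

/-- The number of vertices, univalent and trivalent. -/
def JacobiDiagram.numVertices {n : ℕ} (D : JacobiDiagram n) : ℕ :=
  Fintype.card D.graph.Leg + Fintype.card D.graph.Tri

/-- The degree of a Jacobi diagram is half the number of its vertices. -/
def JacobiDiagram.HasDegree {n : ℕ} (D : JacobiDiagram n) (d : ℕ) : Prop :=
  D.numVertices = 2 * d

/-- The map on half-edges given by a map of legs, a map of trivalent vertices, and a rotation at
each trivalent vertex. -/
def halfEdgeMap {Leg Tri Leg' Tri' : Type} (f : Leg → Leg') (g : Tri → Tri') (rot : Tri → Fin 3) :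
    HalfEdge Leg Tri → HalfEdge Leg' Tri'
  | Sum.inl l => Sum.inl (f l)
  | Sum.inr (t, i) => Sum.inr (g t, i + rot t)

/-- An identification of two Jacobi diagrams on `X_n`: an isomorphism of the graphs which
preserves the cyclic orders at the trivalent vertices and the positions of the univalent
vertices on `X_n`. -/
structure DiagramIso {n : ℕ} (D D' : JacobiDiagram n) where
  leg : D.graph.Leg ≃ D'.graph.Leg
  tri : D.graph.Tri ≃ D'.graph.Tri
  rot : D.graph.Tri → Fin 3
  pair_map : ∀ h, D'.graph.pair (halfEdgeMap leg tri rot h) =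
    halfEdgeMap leg tri rot (D.graph.pair h)
  arc_eq : ∀ x, D'.att.arc (leg x) = D.att.arc x
  before_iff : ∀ x y, D'.att.before (leg x) (leg y) ↔ D.att.before x y

open Classical in
/-- The map on half-edges when the legs `a` and `b` are joined at a new trivalent vertex `tri none`:
the ends at `a` and `b` become the half-edges `2` and `1` of the new vertex. -/
noncomputable def joinHalfEdge {Leg Tri Leg' Tri' : Type} (a b : Leg) (glue : Leg → Leg')
    (tri : Option Tri → Tri') : HalfEdge Leg Tri → HalfEdge Leg' Tri'
  | Sum.inl l =>
      if l = a then Sum.inr (tri none, 2)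
      else if l = b then Sum.inr (tri none, 1)
      else Sum.inl (glue l)
  | Sum.inr (t, i) => Sum.inr (tri (some t), i)

/-- The three diagrams `(G, α)`, `(G, α')` and `S` occur in an STU relation
`S = (G, α) - (G, α')`. In `(G, α)` the legs `a` and `b` are adjacent on an arc, with `a` just
before `b`; in `(G, α')` they are interchanged; in `S` they are replaced by one leg
`glue a = glue b` at the same place, joined to a new trivalent vertex, whose half-edges `0, 1, 2`
lead to this leg, to the former end at `b` and to the former end at `a`. (With the arc drawn
horizontally, oriented from left to right, and the graph above it, this is the counterclockwise
order.) -/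
structure STU {n : ℕ} (G : UniTriGraph) (α α' : Attachment n G.Leg) (S : JacobiDiagram n) where
  a : G.Leg
  b : G.Leg
  glue : G.Leg → S.graph.Leg
  tri : Option G.Tri ≃ S.graph.Tri
  glue_surjective : Function.Surjective glue
  glue_eq_iff : ∀ x y, glue x = glue y ↔ x = y ∨ (x = a ∧ y = b) ∨ (x = b ∧ y = a)
  pair_join : ∀ h, S.graph.pair (joinHalfEdge a b glue tri h) =
    joinHalfEdge a b glue tri (G.pair h)
  pair_new : S.graph.pair (Sum.inl (glue a)) = Sum.inr (tri none, 0)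
  before_ab : α.before a b
  before_ba : α'.before b a
  arc_swap : ∀ x, α'.arc x = α.arc x
  before_swap : ∀ x y, glue x ≠ glue y → (α'.before x y ↔ α.before x y)
  arc_glue : ∀ x, S.att.arc (glue x) = α.arc x
  before_glue : ∀ x y, glue x ≠ glue y → (S.att.before (glue x) (glue y) ↔ α.before x y)

section Space

variable (K : Type u) [Field K]

/-- The relations among Jacobi diagrams on `X_n`: isomorphic diagrams are identified, and the STU
relations hold. -/
inductive IsRelation (n : ℕ) : (JacobiDiagram n →₀ K) → Prop
  | iso {D D' : JacobiDiagram n} (e : DiagramIso D D') :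
      IsRelation n (Finsupp.single D 1 - Finsupp.single D' 1)
  | stu {G : UniTriGraph} {α α' : Attachment n G.Leg} {S : JacobiDiagram n} (s : STU G α α' S) :
      IsRelation n (Finsupp.single ⟨G, α⟩ 1 - Finsupp.single ⟨G, α'⟩ 1 - Finsupp.single S 1)

/-- The span of the relations. -/
noncomputable def relations (n : ℕ) : Submodule K (JacobiDiagram n →₀ K) :=
  Submodule.span K {r | IsRelation K n r}

/-- The vector space `A(X_n)` of Jacobi diagrams on `X_n` modulo the STU relations. -/
abbrev JacobiSpace (n : ℕ) : Type (max u 1) := (JacobiDiagram n →₀ K) ⧸ relations K n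

/-- The class of a Jacobi diagram. -/
noncomputable def mk {n : ℕ} (D : JacobiDiagram n) : JacobiSpace K n :=
  (relations K n).mkQ (Finsupp.single D 1)

/-- The degree `d` part `A_d(n)` of `A(X_n)`. -/
noncomputable def degreePart (d n : ℕ) : Submodule K (JacobiSpace K n) :=
  Submodule.span K {x | ∃ D : JacobiDiagram n, D.HasDegree d ∧ mk K D = x}

/-- The subspace `A_{d,k}(n)` spanned by the diagrams of degree `d` with at least `k` trivalent
vertices. -/
noncomputable def filtrationPart (d n k : ℕ) : Submodule K (JacobiSpace K n) :=
  Submodule.span K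
    {x | ∃ D : JacobiDiagram n, D.HasDegree d ∧ k ≤ D.numTrivalent ∧ mk K D = x}

end Space

/-! ## Composition with a morphism of degree zero

A map `X_n → U_m` of arcs into the handlebody of genus `m` can be deformed so that each handle
contains only strands parallel to the core of the handle. -/

/-- `n` arcs which run through the `m` handles of `U_m`. Each element of `Pass` is one passage of
an arc through a handle: `src` is the handle, `pos` tells whether the passage is in the positive
direction of the handle, and `att` records the arcs on which the passages lie and the order in
which they occur along the arcs. -/
structure Strands (m n : ℕ) where
  Pass : Type
  [fintypePass : Fintype Pass]
  src : Pass → Fin m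
  pos : Pass → Bool
  att : Attachment n Pass

attribute [instance] Strands.fintypePass

/-- When the `i`-th arc of `X_m` is replaced by parallel copies, one for each passage through the
`i`-th handle, every leg has to be moved to one of the copies of its arc. -/
@[ext]
structure Lift {m n : ℕ} (P : Strands m n) {Λ : Type} (α : Attachment m Λ) where
  pass : Λ → P.Pass
  src_pass : ∀ x, P.src (pass x) = α.arc x

open Classical in
noncomputable instance {m n : ℕ} (P : Strands m n) {Λ : Type} [Fintype Λ] (α : Attachment m Λ) :
    Fintype (Lift P α) :=
  Fintype.ofInjective Lift.pass fun _ _ => Lift.ext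

/-- The positions of the legs on the `n` new arcs: legs on different passages are ordered as the
passages are; legs on the same passage keep their order if the passage is positive, and have
their order reversed if it is negative. -/
def liftAttachment {m n : ℕ} (P : Strands m n) {Λ : Type} (α : Attachment m Λ) (φ : Lift P α) :
    Attachment n Λ where
  arc x := P.att.arc (φ.pass x)
  before x y := P.att.before (φ.pass x) (φ.pass y) ∨
    (φ.pass x = φ.pass y ∧ if P.pos (φ.pass x) then α.before x y else α.before y x)
  arc_eq := by
    rintro x y (h | ⟨h, -⟩)
    · exact P.att.arc_eq h
    · rw [h]
  irrefl := by
    rintro x (h | ⟨-, h⟩)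
    · exact P.att.irrefl _ h
    · split_ifs at h <;> exact α.irrefl _ h
  trans := by
    rintro x y z (h | ⟨h, h'⟩) (k | ⟨k, k'⟩)
    · exact Or.inl (P.att.trans h k)
    · exact Or.inl (k ▸ h)
    · exact Or.inl (h ▸ k)
    · refine Or.inr ⟨h.trans k, ?_⟩
      rw [← h] at k'
      split_ifs at h' k' ⊢
      · exact α.trans h' k'
      · exact α.trans k' h'
  total := by
    intro x y h hne
    by_cases e : φ.pass x = φ.pass y
    · have := α.total (by rw [← φ.src_pass x, ← φ.src_pass y, e]) hne
      rw [e]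
      split_ifs <;> tauto
    · rcases P.att.total h e with h | h <;> tauto

section Cabling

variable (K : Type u) [Field K]

/-- Each leg on a negative passage contributes a factor `-1`. -/
def liftSign {m n : ℕ} (P : Strands m n) {Λ : Type} [Fintype Λ] (α : Attachment m Λ)
    (φ : Lift P α) : K :=
  ∏ x, if P.pos (φ.pass x) then 1 else -1

/-- The composite of the strands `P` with the diagram `D` (stacking `P` on the cabling of `D`): the
signed sum of all ways of moving the legs of `D` to the parallel copies of the arcs. -/
noncomputable def cable {m n : ℕ} (P : Strands m n) (D : JacobiDiagram m) : JacobiSpace K n :=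
  ∑ φ : Lift P D.att, liftSign K P D.att φ • mk K ⟨D.graph, liftAttachment P D.att φ⟩

/-- Relabelling the legs. -/
def liftCongr {m n : ℕ} (P : Strands m n) {Λ Λ' : Type} (e : Λ ≃ Λ') {α : Attachment m Λ}
    {α' : Attachment m Λ'} (h : ∀ x, α'.arc (e x) = α.arc x) : Lift P α ≃ Lift P α' where
  toFun φ := ⟨fun x => φ.pass (e.symm x), fun x => by rw [φ.src_pass, ← h, e.apply_symm_apply]⟩
  invFun φ := ⟨fun x => φ.pass (e x), fun x => by rw [φ.src_pass, h]⟩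
  left_inv φ := Lift.ext (funext fun x => by simp)
  right_inv φ := Lift.ext (funext fun x => by simp)

theorem mk_eq_of_iso {n : ℕ} {D D' : JacobiDiagram n} (e : DiagramIso D D') :
    mk K D = mk K D' := by
  rw [mk, mk, ← sub_eq_zero, ← map_sub, Submodule.mkQ_apply, Submodule.Quotient.mk_eq_zero]
  exact Submodule.subset_span (IsRelation.iso e)

theorem mk_stu {n : ℕ} {G : UniTriGraph} {α α' : Attachment n G.Leg} {S : JacobiDiagram n}
    (s : STU G α α' S) : mk K (⟨G, α⟩ : JacobiDiagram n) - mk K ⟨G, α'⟩ = mk K S := by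
  rw [mk, mk, mk, ← sub_eq_zero, ← map_sub, ← map_sub, Submodule.mkQ_apply,
    Submodule.Quotient.mk_eq_zero]
  exact Submodule.subset_span (IsRelation.stu s)

theorem cable_iso {m n : ℕ} (P : Strands m n) {D D' : JacobiDiagram m} (e : DiagramIso D D') :
    cable K P D = cable K P D' := by
  refine Fintype.sum_equiv (liftCongr P e.leg e.arc_eq) _ _ fun φ => ?_
  congr 1
  · refine Fintype.prod_equiv e.leg _ _ fun x => ?_
    simp [liftCongr]
  · refine mk_eq_of_iso K ⟨e.leg, e.tri, e.rot, e.pair_map, fun x => ?_, fun x y => ?_⟩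
    · simp [liftAttachment, liftCongr]
    · simp only [liftAttachment, liftCongr, Equiv.coe_fn_mk, Equiv.symm_apply_apply, e.before_iff]

theorem cable_stu {m n : ℕ} (P : Strands m n) {G : UniTriGraph} {α α' : Attachment m G.Leg}
    {S : JacobiDiagram m} (s : STU G α α' S) :
    cable K P ⟨G, α⟩ - cable K P ⟨G, α'⟩ = cable K P S := by
  classical
  have hab : s.a ≠ s.b := fun h => α.irrefl _ (h ▸ s.before_ab)
  have hgab : s.glue s.a = s.glue s.b := (s.glue_eq_iff _ _).2 (by tauto)
  have e1 : cable K P ⟨G, α'⟩ = ∑ φ : Lift P α, liftSign K P α φ •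
      mk K ⟨G, liftAttachment P α' (liftCongr P (Equiv.refl _) s.arc_swap φ)⟩ := by
    refine (Fintype.sum_equiv (liftCongr P (Equiv.refl _) s.arc_swap) _ _ fun φ => ?_).symm
    rfl
  rw [e1, cable, ← Finset.sum_sub_distrib]
  have e2 : ∀ φ : Lift P α, φ.pass s.a ≠ φ.pass s.b →
      liftAttachment P α φ = liftAttachment P α' (liftCongr P (Equiv.refl _) s.arc_swap φ) := by
    intro φ hφ
    ext x y
    · rfl
    · simp only [liftAttachment, liftCongr, Equiv.coe_fn_mk, Equiv.refl_symm, Equiv.refl_apply]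
      refine or_congr_right (and_congr_right fun hxy => ?_)
      by_cases hg : s.glue x = s.glue y
      · rcases (s.glue_eq_iff _ _).1 hg with rfl | ⟨rfl, rfl⟩ | ⟨rfl, rfl⟩
        · simp [α.irrefl, α'.irrefl]
        · exact absurd hxy hφ
        · exact absurd hxy.symm hφ
      · rw [s.before_swap _ _ hg, s.before_swap _ _ (Ne.symm hg)]
        exact Iff.rfl
  rw [← Finset.sum_filter_add_sum_filter_not Finset.univ (fun φ : Lift P α => φ.pass s.a = φ.pass s.b),
    Finset.sum_eq_zero (s := Finset.filter (fun φ : Lift P α => ¬ φ.pass s.a = φ.pass s.b) _), add_zero]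
  swap
  · intro φ hφ
    rw [e2 φ (Finset.mem_filter.1 hφ).2, sub_self]
  symm
  have hfac : ∀ φ : Lift P α, φ.pass s.a = φ.pass s.b → ∀ x y, s.glue x = s.glue y →
      φ.pass x = φ.pass y := by
    intro φ h x y hxy
    rcases (s.glue_eq_iff _ _).1 hxy with rfl | ⟨rfl, rfl⟩ | ⟨rfl, rfl⟩
    · rfl
    · exact h
    · exact h.symm
  refine Finset.sum_bij'
    (fun ψ _ => (⟨fun x => ψ.pass (s.glue x), fun x => by rw [ψ.src_pass, s.arc_glue]⟩ : Lift P α))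
    (fun φ hφ => (⟨fun y => φ.pass (Function.surjInv s.glue_surjective y), fun y => by
      rw [φ.src_pass, ← s.arc_glue, Function.surjInv_eq s.glue_surjective]⟩ : Lift P S.att)) ?_ ?_ ?_ ?_ ?_
  · intro ψ _
    simp [hgab]
  · intro φ _
    exact Finset.mem_univ _
  · intro ψ _
    refine Lift.ext (funext fun y => ?_)
    simp [Function.surjInv_eq]
  · intro φ hφ
    refine Lift.ext (funext fun x => ?_)
    exact hfac φ (Finset.mem_filter.1 hφ).2 _ _ (Function.surjInv_eq s.glue_surjective _)
  · intro ψ _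
    set φ : Lift P α := ⟨fun x => ψ.pass (s.glue x), fun x => by rw [ψ.src_pass, s.arc_glue]⟩ with hφ
    have hsign : liftSign K P α φ =
        (if P.pos (ψ.pass (s.glue s.a)) then 1 else -1) * liftSign K P S.att ψ := by
      have key : ∀ f : S.graph.Leg → K, ∏ x, f (s.glue x) = f (s.glue s.a) * ∏ y, f y := by
        intro f
        rw [← Finset.mul_prod_erase Finset.univ _ (Finset.mem_univ s.a)]
        congr 1
        refine Finset.prod_bij (fun x _ => s.glue x) (fun x _ => Finset.mem_univ _) ?_ ?_ ?_
        · intro x hx y hy h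
          rw [Finset.mem_erase] at hx hy
          rcases (s.glue_eq_iff _ _).1 h with h | ⟨h, -⟩ | ⟨-, h⟩
          · exact h
          · exact absurd h hx.1
          · exact absurd h hy.1
        · intro y _
          obtain ⟨x, rfl⟩ := s.glue_surjective y
          by_cases hx : x = s.a
          · exact ⟨s.b, Finset.mem_erase.2 ⟨hab.symm, Finset.mem_univ _⟩, by rw [hx, hgab]⟩
          · exact ⟨x, Finset.mem_erase.2 ⟨hx, Finset.mem_univ _⟩, rfl⟩
        · intro x _
          rfl
      exact key fun y => if P.pos (ψ.pass y) then 1 else -1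
    have hbab : ¬ α.before s.b s.a := fun h => α.irrefl _ (α.trans h s.before_ab)
    have hbab' : ¬ α'.before s.a s.b := fun h => α'.irrefl _ (α'.trans h s.before_ba)
    have hne : ∀ x y, s.glue x ≠ s.glue y →
        ((liftAttachment P S.att ψ).before (s.glue x) (s.glue y) ↔
          (liftAttachment P α φ).before x y) := by
      intro x y hxy
      simp only [liftAttachment, hφ, s.before_glue x y hxy, s.before_glue y x hxy.symm]
    have hne' : ∀ x y, s.glue x ≠ s.glue y →
        ((liftAttachment P α' (liftCongr P (Equiv.refl _) s.arc_swap φ)).before x y ↔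
          (liftAttachment P α φ).before x y) := by
      intro x y hxy
      simp only [liftAttachment, liftCongr, Equiv.coe_fn_mk, Equiv.refl_symm, Equiv.refl_apply,
        s.before_swap x y hxy, s.before_swap y x hxy.symm]
    rw [hsign, ← smul_sub]
    by_cases hp : P.pos (ψ.pass (s.glue s.a)) = true
    · have st : STU G (liftAttachment P α φ)
          (liftAttachment P α' (liftCongr P (Equiv.refl _) s.arc_swap φ))
          ⟨S.graph, liftAttachment P S.att ψ⟩ :=
        { a := s.a, b := s.b, glue := s.glue, tri := s.tri
          glue_surjective := s.glue_surjective
          glue_eq_iff := s.glue_eq_iff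
          pair_join := s.pair_join
          pair_new := s.pair_new
          before_ab := Or.inr ⟨by simp [hφ, hgab], by simp [hφ, hp, s.before_ab]⟩
          before_ba := Or.inr ⟨by simp [hφ, liftCongr, hgab], by
            simp [hφ, liftCongr, ← hgab, hp, s.before_ba]⟩
          arc_swap := fun x => rfl
          before_swap := hne'
          arc_glue := fun x => rfl
          before_glue := hne }
      rw [mk_stu K st, if_pos hp, one_mul]
    · have st : STU G (liftAttachment P α' (liftCongr P (Equiv.refl _) s.arc_swap φ))
          (liftAttachment P α φ) ⟨S.graph, liftAttachment P S.att ψ⟩ :=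
        { a := s.a, b := s.b, glue := s.glue, tri := s.tri
          glue_surjective := s.glue_surjective
          glue_eq_iff := s.glue_eq_iff
          pair_join := s.pair_join
          pair_new := s.pair_new
          before_ab := Or.inr ⟨by simp [hφ, liftCongr, hgab], by
            simp [hφ, liftCongr, hp, s.before_ba]⟩
          before_ba := Or.inr ⟨by simp [hφ, hgab], by simp [hφ, ← hgab, hp, s.before_ab]⟩
          arc_swap := fun x => rfl
          before_swap := fun x y h => (hne' x y h).symm
          arc_glue := fun x => rfl
          before_glue := fun x y h => (hne x y h).trans (hne' x y h).symm }
      rw [← mk_stu K st, if_neg hp, neg_one_mul, neg_smul, ← smul_neg, neg_sub]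

/-- Composition with the strands `P`, as a linear map `A(X_m) → A(X_n)`. -/
noncomputable def cableMap {m n : ℕ} (P : Strands m n) : JacobiSpace K m →ₗ[K] JacobiSpace K n :=
  (relations K m).liftQ (Finsupp.linearCombination K (cable K P)) <| by
    rw [relations, Submodule.span_le]
    rintro _ (⟨e⟩ | ⟨s⟩)
    · simp [cable_iso K P e]
    · simp [← cable_stu K P s]

theorem cableMap_mk {m n : ℕ} (P : Strands m n) (D : JacobiDiagram m) :
    cableMap K P (mk K D) = cable K P D := by
  simp [cableMap, mk]

theorem hom_ext {m : ℕ} {W : Type*} [AddCommGroup W] [Module K W] {f g : JacobiSpace K m →ₗ[K] W}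
    (h : ∀ D, f (mk K D) = g (mk K D)) : f = g := by
  refine Submodule.linearMap_qext _ (Finsupp.lhom_ext' fun D => LinearMap.ext_ring ?_)
  exact h D

/-- An isomorphism of systems of strands. -/
structure StrandsIso {m n : ℕ} (P P' : Strands m n) where
  pass : P.Pass ≃ P'.Pass
  src_eq : ∀ o, P'.src (pass o) = P.src o
  pos_eq : ∀ o, P'.pos (pass o) = P.pos o
  arc_eq : ∀ o, P'.att.arc (pass o) = P.att.arc o
  before_iff : ∀ o o', P'.att.before (pass o) (pass o') ↔ P.att.before o o'

theorem cable_strandsIso {m n : ℕ} {P P' : Strands m n} (e : StrandsIso P P')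
    (D : JacobiDiagram m) : cable K P D = cable K P' D := by
  let f : Lift P D.att ≃ Lift P' D.att :=
    { toFun := fun φ => ⟨fun x => e.pass (φ.pass x), fun x => by rw [e.src_eq, φ.src_pass]⟩
      invFun := fun φ => ⟨fun x => e.pass.symm (φ.pass x), fun x => by
        rw [← e.src_eq, e.pass.apply_symm_apply, φ.src_pass]⟩
      left_inv := fun φ => Lift.ext (funext fun x => by simp)
      right_inv := fun φ => Lift.ext (funext fun x => by simp) }
  refine Fintype.sum_equiv f _ _ fun φ => ?_
  congr 1
  · exact Finset.prod_congr rfl fun x _ => by simp [f, e.pos_eq]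
  · congr 2
    ext x y
    · simp [liftAttachment, f, e.arc_eq]
    · simp [liftAttachment, f, e.before_iff, e.pos_eq]

theorem cableMap_strandsIso {m n : ℕ} {P P' : Strands m n} (e : StrandsIso P P') :
    cableMap K P = cableMap K P' :=
  hom_ext K fun D => by rw [cableMap_mk, cableMap_mk, cable_strandsIso K e]

/-- The composite of two systems of strands. -/
def Strands.comp {m n p : ℕ} (P : Strands m n) (Q : Strands n p) : Strands m p where
  Pass := {x : Q.Pass × P.Pass // P.att.arc x.2 = Q.src x.1}
  fintypePass := inferInstance
  src x := P.src x.1.2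
  pos x := if Q.pos x.1.1 then P.pos x.1.2 else !P.pos x.1.2
  att :=
    { arc := fun x => Q.att.arc x.1.1
      before := fun x y => Q.att.before x.1.1 y.1.1 ∨ (x.1.1 = y.1.1 ∧
        if Q.pos x.1.1 then P.att.before x.1.2 y.1.2 else P.att.before y.1.2 x.1.2)
      arc_eq := by
        rintro x y (h | ⟨h, -⟩)
        · exact Q.att.arc_eq h
        · rw [h]
      irrefl := by
        rintro x (h | ⟨-, h⟩)
        · exact Q.att.irrefl _ h
        · split_ifs at h <;> exact P.att.irrefl _ h
      trans := by
        rintro x y z (h | ⟨h, h'⟩) (k | ⟨k, k'⟩)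
        · exact Or.inl (Q.att.trans h k)
        · exact Or.inl (k ▸ h)
        · exact Or.inl (h ▸ k)
        · refine Or.inr ⟨h.trans k, ?_⟩
          rw [← h] at k'
          split_ifs at h' k' ⊢
          · exact P.att.trans h' k'
          · exact P.att.trans k' h'
      total := by
        rintro ⟨⟨q, o⟩, h⟩ ⟨⟨q', o'⟩, h'⟩ hq hne
        dsimp only at h h' hq ⊢
        by_cases e : q = q'
        · subst e
          have hne' : o ≠ o' := fun e => hne (by subst e; rfl)
          have := P.att.total (h.trans h'.symm) hne'
          split_ifs <;> tauto
        · rcases Q.att.total hq e with h | h <;> tauto }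

theorem cableMap_comp {m n p : ℕ} (P : Strands m n) (Q : Strands n p) :
    cableMap K (P.comp Q) = cableMap K Q ∘ₗ cableMap K P := by
  refine hom_ext K fun D => ?_
  simp only [LinearMap.comp_apply, cableMap_mk]
  rw [cable, cable, map_sum]
  simp only [map_smul, cableMap_mk]
  simp only [cable, Finset.smul_sum, smul_smul]
  rw [← Fintype.sum_sigma']
  symm
  let f : ((φ : Lift P D.att) × Lift Q (liftAttachment P D.att φ)) ≃ Lift (P.comp Q) D.att :=
    { toFun := fun x => ⟨fun l => ⟨(x.2.pass l, x.1.pass l), (x.2.src_pass l).symm⟩, fun l =>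
        x.1.src_pass l⟩
      invFun := fun χ => ⟨⟨fun l => (χ.pass l).1.2, fun l => χ.src_pass l⟩,
        ⟨fun l => (χ.pass l).1.1, fun l => (χ.pass l).2.symm⟩⟩
      left_inv := fun x => rfl
      right_inv := fun χ => rfl }
  refine Fintype.sum_equiv f _ _ fun x => ?_
  congr 1
  · simp only [liftSign, ← Finset.prod_mul_distrib]
    refine Finset.prod_congr rfl fun l _ => ?_
    change ((if P.pos (x.1.pass l) then 1 else -1) * (if Q.pos (x.2.pass l) then 1 else -1) : K) =
      if (if Q.pos (x.2.pass l) then P.pos (x.1.pass l) else !P.pos (x.1.pass l)) then 1 else -1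
    cases P.pos (x.1.pass l) <;> cases Q.pos (x.2.pass l) <;> simp
  · congr 2
    ext l l'
    · rfl
    · have hf : (f x).pass l = (f x).pass l' ↔
          x.2.pass l = x.2.pass l' ∧ x.1.pass l = x.1.pass l' :=
        ⟨fun h => ⟨congrArg (fun y => y.1.1) h, congrArg (fun y => y.1.2) h⟩,
          fun h => Subtype.ext (Prod.ext h.1 h.2)⟩
      change (Q.att.before (x.2.pass l) (x.2.pass l') ∨ (x.2.pass l = x.2.pass l' ∧
          if Q.pos (x.2.pass l) then
            P.att.before (x.1.pass l) (x.1.pass l') ∨ (x.1.pass l = x.1.pass l' ∧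
              if P.pos (x.1.pass l) then D.att.before l l' else D.att.before l' l)
          else
            P.att.before (x.1.pass l') (x.1.pass l) ∨ (x.1.pass l' = x.1.pass l ∧
              if P.pos (x.1.pass l') then D.att.before l' l else D.att.before l l'))) ↔
        ((Q.att.before (x.2.pass l) (x.2.pass l') ∨ (x.2.pass l = x.2.pass l' ∧
          if Q.pos (x.2.pass l) then P.att.before (x.1.pass l) (x.1.pass l')
          else P.att.before (x.1.pass l') (x.1.pass l))) ∨
        ((f x).pass l = (f x).pass l' ∧
          if (if Q.pos (x.2.pass l) then P.pos (x.1.pass l) else !P.pos (x.1.pass l))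
          then D.att.before l l' else D.att.before l' l))
      rw [hf]
      grind

/-- Keeping only some of the passages. -/
def Strands.restrict {m n : ℕ} (P : Strands m n) (p : P.Pass → Prop) [DecidablePred p] :
    Strands m n where
  Pass := {o // p o}
  src o := P.src o.1
  pos o := P.pos o.1
  att :=
    { arc := fun o => P.att.arc o.1
      before := fun o o' => P.att.before o.1 o'.1
      arc_eq := fun h => P.att.arc_eq h
      irrefl := fun o => P.att.irrefl o.1
      trans := fun h h' => P.att.trans h h'
      total := fun h hne => P.att.total h fun e => hne (Subtype.ext e) }


theorem toggle_right {Pass : Type} {B : Pass → Pass → Prop} {pos : Pass → Bool} {o₁ o₂ p p' q : Pass}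
    {c c' : Prop}
    (irr : ∀ o, ¬ B o o) (hpos : pos o₂ = !pos o₁) (hbef : B o₁ o₂) (hnb : ¬ B o₂ o₁)
    (hne : o₁ ≠ o₂)
    (hadj : q ≠ o₁ → q ≠ o₂ → (B o₁ q ↔ B o₂ q))
    (hp : p = o₁ ∧ p' = o₂ ∨ p = o₂ ∧ p' = o₁)
    (hq : q = o₁ ∨ q = o₂ → if pos o₁ then c' ∧ ¬ c else c ∧ ¬ c') :
    (B p' q ∨ (p' = q ∧ if pos p' then c else c')) ↔ (B p q ∨ (p = q ∧ if pos p then c else c')) := by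
  have hne' := hne.symm
  by_cases hq' : q = o₁ ∨ q = o₂
  · have hq := hq hq'
    cases h : pos o₁ <;> rcases hq' with rfl | rfl <;>
      rcases hp with ⟨rfl, rfl⟩ | ⟨rfl, rfl⟩ <;> simp_all
  · have := hadj (by tauto) (by tauto)
    rcases hp with ⟨rfl, rfl⟩ | ⟨rfl, rfl⟩ <;> grind

theorem toggle_left {Pass : Type} {B : Pass → Pass → Prop} {pos : Pass → Bool} {o₁ o₂ p p' q : Pass}
    {c c' : Prop}
    (irr : ∀ o, ¬ B o o) (hpos : pos o₂ = !pos o₁) (hbef : B o₁ o₂) (hnb : ¬ B o₂ o₁)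
    (hne : o₁ ≠ o₂)
    (hadj : q ≠ o₁ → q ≠ o₂ → (B q o₁ ↔ B q o₂))
    (hp : p = o₁ ∧ p' = o₂ ∨ p = o₂ ∧ p' = o₁)
    (hq : q = o₁ ∨ q = o₂ → if pos o₁ then c ∧ ¬ c' else c' ∧ ¬ c) :
    (B q p' ∨ (q = p' ∧ if pos q then c else c')) ↔ (B q p ∨ (q = p ∧ if pos q then c else c')) := by
  have hne' := hne.symm
  by_cases hq' : q = o₁ ∨ q = o₂
  · have hq := hq hq'
    cases h : pos o₁ <;> rcases hq' with rfl | rfl <;>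
      rcases hp with ⟨rfl, rfl⟩ | ⟨rfl, rfl⟩ <;> simp_all
  · have := hadj (by tauto) (by tauto)
    rcases hp with ⟨rfl, rfl⟩ | ⟨rfl, rfl⟩ <;> grind

theorem exists_extremal {n : ℕ} {Λ : Type} [Finite Λ] (α : Attachment n Λ) (b : Bool) (s : Set Λ)
    (hs : s.Nonempty) (harc : ∀ x ∈ s, ∀ y ∈ s, α.arc x = α.arc y) :
    ∃ x ∈ s, ∀ y ∈ s, y ≠ x → if b then α.before y x else α.before x y := by
  have key : ∀ r : Λ → Λ → Prop, (∀ x, ¬ r x x) → (∀ x y z, r x y → r y z → r x z) →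
      (∀ x ∈ s, ∀ y ∈ s, x ≠ y → r x y ∨ r y x) → ∃ x ∈ s, ∀ y ∈ s, y ≠ x → r x y := by
    intro r h1 h2 h3
    have : Std.Irrefl r := ⟨h1⟩
    have : IsTrans Λ r := ⟨h2⟩
    obtain ⟨x, hx, hmin⟩ := (Finite.wellFounded_of_trans_of_irrefl r).has_min s hs
    exact ⟨x, hx, fun y hy hne => (h3 y hy x hx hne).resolve_left (hmin y hy)⟩
  cases b
  · simpa using key α.before α.irrefl (fun _ _ _ => α.trans)
      fun x hx y hy hne => α.total (harc x hx y hy) hne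
  · simpa using key (fun x y => α.before y x) α.irrefl (fun _ _ _ h h' => α.trans h' h)
      fun x hx y hy hne => (α.total (harc x hx y hy) hne).symm

open Classical in
/-- Two consecutive passages through the same handle in opposite directions cancel. -/
theorem cable_cancel {m n : ℕ} (P : Strands m n) (o₁ o₂ : P.Pass) (hsrc : P.src o₁ = P.src o₂)
    (hpos : P.pos o₂ = !P.pos o₁) (hbef : P.att.before o₁ o₂)
    (hadj₁ : ∀ o, o ≠ o₁ → o ≠ o₂ → (P.att.before o o₁ ↔ P.att.before o o₂))
    (hadj₂ : ∀ o, o ≠ o₁ → o ≠ o₂ → (P.att.before o₁ o ↔ P.att.before o₂ o))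
    (D : JacobiDiagram m) :
    cable K P D = cable K (P.restrict fun o => o ≠ o₁ ∧ o ≠ o₂) D := by
  have hne : o₁ ≠ o₂ := fun h => P.att.irrefl _ (h ▸ hbef)
  have hnb : ¬ P.att.before o₂ o₁ := fun h => P.att.irrefl _ (P.att.trans h hbef)
  rw [cable, ← Finset.sum_filter_add_sum_filter_not Finset.univ
    (fun φ : Lift P D.att => ∀ x, φ.pass x ≠ o₁ ∧ φ.pass x ≠ o₂)]
  have hzero : ∑ φ ∈ Finset.univ.filter
      (fun φ : Lift P D.att => ¬ ∀ x, φ.pass x ≠ o₁ ∧ φ.pass x ≠ o₂),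
      liftSign K P D.att φ • mk K ⟨D.graph, liftAttachment P D.att φ⟩ = 0 := by
    rcases isEmpty_or_nonempty D.graph.Leg with hemp | hnemp
    · refine Finset.sum_eq_zero fun φ hφ => absurd ?_ (Finset.mem_filter.1 hφ).2
      exact fun x => hemp.elim x
    have hex : ∀ φ : Lift P D.att, (¬ ∀ x, φ.pass x ≠ o₁ ∧ φ.pass x ≠ o₂) →
        ∃ x ∈ {x | φ.pass x = o₁ ∨ φ.pass x = o₂}, ∀ y ∈ {x | φ.pass x = o₁ ∨ φ.pass x = o₂},
          y ≠ x → if P.pos o₁ then D.att.before y x else D.att.before x y := by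
      intro φ hφ
      refine exists_extremal D.att _ _ ?_ ?_
      · push Not at hφ
        obtain ⟨x, hx⟩ := hφ
        exact ⟨x, by by_cases h : φ.pass x = o₁ <;> simp_all⟩
      · rintro x hx y hy
        rw [← φ.src_pass, ← φ.src_pass]
        rcases hx with hx | hx <;> rcases hy with hy | hy <;> simp [hx, hy, hsrc]
    have huniq : ∀ (s : Set D.graph.Leg) (x y : D.graph.Leg), x ∈ s → y ∈ s →
        (∀ z ∈ s, z ≠ x → if P.pos o₁ then D.att.before z x else D.att.before x z) →
        (∀ z ∈ s, z ≠ y → if P.pos o₁ then D.att.before z y else D.att.before y z) → x = y := by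
      intro s x y hx hy h h'
      by_contra hxy
      have h1 := h y hy (Ne.symm hxy)
      have h2 := h' x hx hxy
      split_ifs at h1 h2 <;> exact D.att.irrefl _ (D.att.trans h1 h2)
    choose! e he hmax using hex
    let sw : P.Pass → P.Pass := Equiv.swap o₁ o₂
    have hswsrc : ∀ o, P.src (sw o) = P.src o := by
      intro o
      by_cases h1 : o = o₁
      · simp [sw, h1, hsrc]
      by_cases h2 : o = o₂
      · simp [sw, h2, hsrc]
      simp [sw, Equiv.swap_apply_of_ne_of_ne h1 h2]
    let g : Lift P D.att → Lift P D.att := fun φ =>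
      ⟨fun x => if x = e φ then sw (φ.pass x) else φ.pass x, fun x => by
        split_ifs
        · rw [hswsrc, φ.src_pass]
        · rw [φ.src_pass]⟩
    have hmem : ∀ φ : Lift P D.att, ∀ x, ((g φ).pass x = o₁ ∨ (g φ).pass x = o₂) ↔
        (φ.pass x = o₁ ∨ φ.pass x = o₂) := by
      intro φ x
      simp only [g]
      split_ifs with h
      · simp only [sw, Equiv.swap_apply_eq_iff, Equiv.swap_apply_left, Equiv.swap_apply_right]
        tauto
      · rfl
    have hbad : ∀ φ : Lift P D.att, (¬ ∀ x, φ.pass x ≠ o₁ ∧ φ.pass x ≠ o₂) →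
        ¬ ∀ x, (g φ).pass x ≠ o₁ ∧ (g φ).pass x ≠ o₂ := by
      intro φ hφ h
      refine hφ fun x => ?_
      have := hmem φ x
      have := h x
      tauto
    have heg : ∀ φ : Lift P D.att, (¬ ∀ x, φ.pass x ≠ o₁ ∧ φ.pass x ≠ o₂) → e (g φ) = e φ := by
      intro φ hφ
      refine huniq {x | φ.pass x = o₁ ∨ φ.pass x = o₂} _ _ ?_ (he φ hφ) ?_ (hmax φ hφ)
      · exact (hmem φ _).1 (he _ (hbad φ hφ))
      · exact fun z hz => hmax _ (hbad φ hφ) z ((hmem φ z).2 hz)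
    have hswpos : ∀ o, o = o₁ ∨ o = o₂ → P.pos (sw o) = !P.pos o := by
      rintro o (rfl | rfl) <;> simp [sw, hpos]
    refine Finset.sum_involution (fun φ _ => g φ) ?_ ?_ ?_ ?_
    · intro φ hφ
      have hφ' := (Finset.mem_filter.1 hφ).2
      have hs : liftSign K P D.att (g φ) = - liftSign K P D.att φ := by
        rw [liftSign, liftSign, ← Finset.mul_prod_erase Finset.univ _ (Finset.mem_univ (e φ)),
          ← Finset.mul_prod_erase Finset.univ (fun x => if P.pos (φ.pass x) then (1 : K) else -1)
            (Finset.mem_univ (e φ)), ← neg_mul]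
        congr 1
        · simp only [g, if_true]
          rw [hswpos _ (he φ hφ')]
          cases P.pos (φ.pass (e φ)) <;> simp
        · refine Finset.prod_congr rfl fun x hx => ?_
          simp [g, (Finset.mem_erase.1 hx).1]
      have ha : liftAttachment P D.att (g φ) = liftAttachment P D.att φ := by
        have harc : ∀ o, P.att.arc (sw o) = P.att.arc o := by
          intro o
          by_cases h1 : o = o₁
          · simp [sw, h1, P.att.arc_eq hbef]
          by_cases h2 : o = o₂
          · simp [sw, h2, P.att.arc_eq hbef]
          simp [sw, Equiv.swap_apply_of_ne_of_ne h1 h2]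
        ext x y
        · simp only [liftAttachment, g]
          split_ifs
          · rw [harc]
          · rfl
        · have h0 := he φ hφ'
          have hx := hmax φ hφ' x
          have hy := hmax φ hφ' y
          have i0 := P.att.irrefl
          have j0 := D.att.irrefl
          have j1 : ∀ x y, D.att.before x y → ¬ D.att.before y x :=
            fun x y h h' => D.att.irrefl _ (D.att.trans h h')
          have s1 : sw o₁ = o₂ := by simp [sw]
          have s2 : sw o₂ = o₁ := by simp [sw]
          simp only [Set.mem_ofPred_eq] at h0 hx hy
          have gp : ∀ x, x = e φ → (g φ).pass x = sw (φ.pass x) := fun x hx => if_pos hx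
          have gn : ∀ x, x ≠ e φ → (g φ).pass x = φ.pass x := fun x hx => if_neg hx
          have hp : φ.pass (e φ) = o₁ ∧ sw (φ.pass (e φ)) = o₂ ∨
              φ.pass (e φ) = o₂ ∧ sw (φ.pass (e φ)) = o₁ := by
            rcases h0 with h | h
            · exact Or.inl ⟨h, by rw [h, s1]⟩
            · exact Or.inr ⟨h, by rw [h, s2]⟩
          simp only [liftAttachment]
          by_cases hxe : x = e φ <;> by_cases hye : y = e φ
          · rw [gp x hxe, gp y hye, hxe, hye]
            simp [i0, j0]
          · rw [gp x hxe, gn y hye, hxe]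
            refine toggle_right i0 hpos hbef hnb hne (hadj₂ _) hp fun h => ?_
            have := hy h hye
            split_ifs at this ⊢ <;> exact ⟨this, j1 _ _ this⟩
          · rw [gn x hxe, gp y hye, hye]
            refine toggle_left i0 hpos hbef hnb hne (hadj₁ _) hp fun h => ?_
            have := hx h hxe
            split_ifs at this ⊢ <;> exact ⟨this, j1 _ _ this⟩
          · rw [gn x hxe, gn y hye]
      rw [hs, ha, neg_smul, add_neg_cancel]
    · intro φ hφ _ h
      have hφ' := (Finset.mem_filter.1 hφ).2
      have := congrArg (fun ψ => ψ.pass (e φ)) h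
      simp only [g, if_true] at this
      rcases he φ hφ' with h' | h' <;> rw [h'] at this <;> simp [sw] at this
      · exact hne this.symm
      · exact hne this
    · intro φ hφ
      exact Finset.mem_filter.2 ⟨Finset.mem_univ _, hbad φ (Finset.mem_filter.1 hφ).2⟩
    · intro φ hφ
      have hφ' := (Finset.mem_filter.1 hφ).2
      refine Lift.ext (funext fun x => ?_)
      change (if x = e (g φ) then sw (if x = e φ then sw (φ.pass x) else φ.pass x)
        else (if x = e φ then sw (φ.pass x) else φ.pass x)) = φ.pass x
      rw [heg φ hφ']
      split_ifs
      · simp [sw]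
      · rfl
  rw [hzero, add_zero]
  refine Finset.sum_bij'
    (fun φ hφ => (⟨fun x => ⟨φ.pass x, (Finset.mem_filter.1 hφ).2 x⟩, φ.src_pass⟩ :
      Lift (P.restrict fun o => o ≠ o₁ ∧ o ≠ o₂) D.att))
    (fun ψ _ => (⟨fun x => (ψ.pass x).1, ψ.src_pass⟩ : Lift P D.att)) ?_ ?_ ?_ ?_ ?_
  · intro φ _
    exact Finset.mem_univ _
  · intro ψ _
    exact Finset.mem_filter.2 ⟨Finset.mem_univ _, fun x => (ψ.pass x).2⟩
  · intro φ _
    rfl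
  · intro ψ _
    rfl
  · intro φ hφ
    congr 1
    congr 2
    ext x y
    · rfl
    · exact or_congr Iff.rfl (and_congr (by
        exact ⟨fun h => Subtype.ext h, fun h => congrArg Subtype.val h⟩) Iff.rfl)

/-- Arcs given by words: the `j`-th arc runs through the handles as prescribed by the word `w j`,
where `(i, true)` stands for `x_i` and `(i, false)` for `x_i⁻¹`. A product of loops is written in
the opposite order: `γ₂ γ₁` runs through `γ₁` first, so the last letter of the word is the first
passage. -/
def strandsOfWords {m n : ℕ} (w : Fin n → List (Fin m × Bool)) : Strands m n where
  Pass := (j : Fin n) × Fin (w j).length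
  src o := ((w o.1)[o.2]).1
  pos o := ((w o.1)[o.2]).2
  att :=
    { arc := fun o => o.1
      before := fun o o' => o.1 = o'.1 ∧ o'.2.val < o.2.val
      arc_eq := fun h => h.1
      irrefl := fun o h => lt_irrefl _ h.2
      trans := fun h h' => ⟨h.1.trans h'.1, h'.2.trans h.2⟩
      total := by
        rintro ⟨j, i⟩ ⟨j', i'⟩ h hne
        dsimp only at h
        subst h
        have : i.val ≠ i'.val := fun e => hne (by rw [Fin.ext e])
        rcases lt_or_gt_of_ne this with h | h
        · exact Or.inr ⟨rfl, h⟩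
        · exact Or.inl ⟨rfl, h⟩ }

/-- The passages of `P` along the `j`-th arc, listed from the last one to the first one, spell the
word `w j`. -/
def Realizes {m n : ℕ} (P : Strands m n) (w : Fin n → List (Fin m × Bool)) : Prop :=
  ∃ L : Fin n → List P.Pass, (∀ j o, o ∈ L j ↔ P.att.arc o = j) ∧
    (∀ j, (L j).Pairwise fun o o' => P.att.before o' o) ∧
    ∀ j, (L j).map (fun o => (P.src o, P.pos o)) = w j

theorem Realizes.iso {m n : ℕ} {P : Strands m n} {w : Fin n → List (Fin m × Bool)}
    (h : Realizes P w) : Nonempty (StrandsIso (strandsOfWords w) P) := by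
  obtain ⟨L, hmem, hpw, hmap⟩ := h
  obtain rfl : (fun j => (L j).map (fun o => (P.src o, P.pos o))) = w := funext hmap
  have hlen : ∀ j, ((L j).map (fun o => (P.src o, P.pos o))).length = (L j).length := fun j => by
    simp
  let f : (strandsOfWords fun j => (L j).map (fun o => (P.src o, P.pos o))).Pass → P.Pass :=
    fun o => (L o.1)[o.2.val]'((hlen o.1) ▸ o.2.isLt)
  have hfarc : ∀ o, P.att.arc (f o) = o.1 := fun o => (hmem _ _).1 (List.getElem_mem _)
  have hbef : ∀ o o' : (strandsOfWords fun j => (L j).map (fun o => (P.src o, P.pos o))).Pass,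
      (strandsOfWords fun j => (L j).map (fun o => (P.src o, P.pos o))).att.before o o' →
        P.att.before (f o) (f o') := by
    rintro ⟨j, i⟩ ⟨j', i'⟩ ⟨h, h'⟩
    dsimp only at h h'
    subst h
    exact List.pairwise_iff_getElem.1 (hpw j) _ _ _ _ h'
  have hinj : Function.Injective f := by
    intro o o' h
    by_contra hne
    rcases (strandsOfWords fun j => (L j).map (fun o => (P.src o, P.pos o))).att.total
      (x := o) (y := o') (by
        change o.1 = o'.1
        rw [← hfarc o, ← hfarc o', h]) hne with h' | h'
    · exact P.att.irrefl _ (h ▸ hbef _ _ h')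
    · exact P.att.irrefl _ (h ▸ hbef _ _ h')
  have hsurj : Function.Surjective f := by
    intro o
    obtain ⟨i, hi, h⟩ := List.getElem_of_mem ((hmem _ o).2 rfl)
    exact ⟨⟨_, ⟨i, by rw [hlen]; exact hi⟩⟩, h⟩
  refine ⟨⟨Equiv.ofBijective f ⟨hinj, hsurj⟩, fun o => ?_, fun o => ?_, hfarc, fun o o' => ?_⟩⟩
  · change P.src (f o) = _
    simp [f, strandsOfWords]
  · change P.pos (f o) = _
    simp [f, strandsOfWords]
  · refine ⟨fun h => ?_, hbef o o'⟩
    have harc : o.1 = o'.1 := by rw [← hfarc o, ← hfarc o']; exact P.att.arc_eq h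
    have hne : o ≠ o' := fun e => P.att.irrefl _ (e ▸ h)
    rcases (strandsOfWords fun j => (L j).map (fun o => (P.src o, P.pos o))).att.total
      (x := o) (y := o') harc hne with h' | h'
    · exact h'
    · exact absurd (P.att.trans h (hbef _ _ h')) (P.att.irrefl _)

theorem Realizes.cableMap_eq {m n : ℕ} {P : Strands m n} {w : Fin n → List (Fin m × Bool)}
    (h : Realizes P w) : cableMap K P = cableMap K (strandsOfWords w) := by
  obtain ⟨e⟩ := h.iso
  exact (cableMap_strandsIso K e).symm

theorem realizes_strandsOfWords {m n : ℕ} (w : Fin n → List (Fin m × Bool)) :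
    Realizes (strandsOfWords w) w := by
  have h1 : ∀ j, ∀ o : (j : Fin n) × Fin (w j).length,
      o ∈ (List.finRange (w j).length).map (Sigma.mk j) ↔ o.1 = j := by
    rintro j ⟨j', i⟩
    rw [List.mem_map]
    constructor
    · rintro ⟨i', -, h⟩
      exact (congrArg Sigma.fst h).symm
    · rintro rfl
      exact ⟨i, List.mem_finRange _, rfl⟩
  have h2 : ∀ j, ((List.finRange (w j).length).map (Sigma.mk j)).Pairwise
      fun (o o' : (j : Fin n) × Fin (w j).length) => o'.1 = o.1 ∧ o.2.val < o'.2.val := by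
    intro j
    rw [List.pairwise_map]
    exact (List.pairwise_lt_finRange _).imp fun h => ⟨rfl, h⟩
  have h3 : ∀ j, ((List.finRange (w j).length).map (Sigma.mk j)).map
      (fun o : (j : Fin n) × Fin (w j).length => (((w o.1)[o.2]).1, ((w o.1)[o.2]).2)) = w j := by
    intro j
    rw [List.map_map]
    exact List.ext_getElem (by simp) fun i h h' => by simp
  exact ⟨_, h1, h2, h3⟩

/-- Substitution of the words `w` into the word `v`. -/
def substWord {m n : ℕ} (w : Fin n → List (Fin m × Bool)) (v : List (Fin n × Bool)) :
    List (Fin m × Bool) :=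
  v.flatMap fun a => if a.2 then w a.1 else FreeGroup.invRev (w a.1)

theorem mk_substWord {m n : ℕ} (w : Fin n → List (Fin m × Bool)) (v : List (Fin n × Bool)) :
    FreeGroup.mk (substWord w v) = FreeGroup.lift (fun i => FreeGroup.mk (w i)) (FreeGroup.mk v) := by
  induction v with
  | nil => rfl
  | cons a v ih =>
    rw [← List.singleton_append, ← FreeGroup.mul_mk, map_mul, ← ih, substWord, List.flatMap_append,
      ← FreeGroup.mul_mk]
    congr 1
    obtain ⟨i, b⟩ := a
    cases b <;> simp

theorem Realizes.comp {m n p : ℕ} {P : Strands m n} {Q : Strands n p}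
    {w : Fin n → List (Fin m × Bool)} {v : Fin p → List (Fin n × Bool)}
    (hP : Realizes P w) (hQ : Realizes Q v) :
    Realizes (P.comp Q) fun k => substWord w (v k) := by
  obtain ⟨L, hmem, hpw, hmap⟩ := hP
  obtain ⟨M, hmem', hpw', hmap'⟩ := hQ
  let N : Q.Pass → List P.Pass := fun q => if Q.pos q then L (Q.src q) else (L (Q.src q)).reverse
  have hN : ∀ q o, o ∈ N q ↔ P.att.arc o = Q.src q := by
    intro q o
    simp only [N]
    split_ifs <;> simp [hmem]
  let R : Q.Pass → List {x : Q.Pass × P.Pass // P.att.arc x.2 = Q.src x.1} := fun q =>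
    (N q).pmap (fun o h => ⟨(q, o), h⟩) fun o h => (hN q o).1 h
  have hR : ∀ q x, x ∈ R q ↔ x.1.1 = q := by
    rintro q ⟨⟨q', o⟩, h⟩
    simp only [R, List.mem_pmap]
    constructor
    · rintro ⟨o', _, e⟩
      exact (congrArg (fun y : {x : Q.Pass × P.Pass // P.att.arc x.2 = Q.src x.1} => y.1.1) e).symm
    · rintro rfl
      exact ⟨o, (hN _ _).2 h, rfl⟩
  have h1 : ∀ k, ∀ x : {x : Q.Pass × P.Pass // P.att.arc x.2 = Q.src x.1},
      x ∈ (M k).flatMap R ↔ Q.att.arc x.1.1 = k := by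
    intro k x
    rw [List.mem_flatMap]
    constructor
    · rintro ⟨q, hq, hx⟩
      rw [← (hmem' _ _).1 hq, ← (hR _ _).1 hx]
    · intro h
      exact ⟨x.1.1, (hmem' _ _).2 h, (hR _ _).2 rfl⟩
  have h2 : ∀ k, ((M k).flatMap R).Pairwise fun y x =>
      Q.att.before x.1.1 y.1.1 ∨ (x.1.1 = y.1.1 ∧
        if Q.pos x.1.1 then P.att.before x.1.2 y.1.2 else P.att.before y.1.2 x.1.2) := by
    intro k
    rw [List.pairwise_flatMap]
    refine ⟨fun q _ => ?_, (hpw' k).imp fun {q q'} h x hx y hy => ?_⟩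
    · have : (N q).Pairwise fun o o' => if Q.pos q then P.att.before o' o else P.att.before o o' := by
        simp only [N]
        split_ifs
        · exact hpw _
        · exact List.pairwise_reverse.2 (hpw _)
      simp only [R]
      refine List.Pairwise.pmap this _ fun o _ o' _ h => Or.inr ⟨rfl, h⟩
    · refine Or.inl ?_
      rw [(hR _ _).1 hx, (hR _ _).1 hy]
      exact h
  have h3 : ∀ k, ((M k).flatMap R).map (fun x => (P.src x.1.2,
      if Q.pos x.1.1 then P.pos x.1.2 else !P.pos x.1.2)) = substWord w (v k) := by
    intro k
    unfold substWord
    rw [← hmap' k, List.map_flatMap, List.flatMap_map]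
    congr 1
    funext q
    simp only [R, List.map_pmap, List.pmap_eq_map, N]
    cases Q.pos q
    · simp [FreeGroup.invRev, ← hmap, Function.comp_def]
    · simp [← hmap]
  exact ⟨_, h1, h2, h3⟩

theorem Realizes.step {m n : ℕ} {P : Strands m n} {w : Fin n → List (Fin m × Bool)}
    (hP : Realizes P w) (j : Fin n) (l : List (Fin m × Bool)) (h : FreeGroup.Red.Step (w j) l) :
    cableMap K P = cableMap K (strandsOfWords (Function.update w j l)) := by
  classical
  obtain ⟨L, hmem, hpw, hmap⟩ := hP
  generalize hv : w j = v at h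
  obtain @⟨l₁, l₂, x, b⟩ := h
  have hj := (hmap j).trans hv
  obtain ⟨m₁, m', hm, hm₁, hm'⟩ := List.map_eq_append_iff.1 hj
  obtain ⟨o₁, m'', rfl, ho₁, hm''⟩ := List.map_eq_cons_iff.1 hm'
  obtain ⟨o₂, m₂, rfl, ho₂, hm₂⟩ := List.map_eq_cons_iff.1 hm''
  have hp := hpw j
  rw [hm, List.pairwise_append] at hp
  obtain ⟨hp₁, hp₂, hp₁₂⟩ := hp
  rw [List.pairwise_cons, List.pairwise_cons] at hp₂
  obtain ⟨hpo₁, hpo₂, hp₂⟩ := hp₂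
  have has : ∀ o o', P.att.before o o' → ¬ P.att.before o' o :=
    fun o o' h h' => P.att.irrefl _ (P.att.trans h h')
  have hbef : P.att.before o₂ o₁ := hpo₁ o₂ (by simp)
  have harc₁ : P.att.arc o₁ = j := (hmem _ _).1 (by simp [hm])
  have harc₂ : P.att.arc o₂ = j := (hmem _ _).1 (by simp [hm])
  have hcase : ∀ o, P.att.arc o = j → o ≠ o₁ → o ≠ o₂ → o ∈ m₁ ∨ o ∈ m₂ := by
    intro o ho h1 h2
    have := (hmem j o).2 ho
    rw [hm] at this
    simp only [List.mem_append, List.mem_cons] at this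
    tauto
  have ha : ∀ o ∈ m₁, P.att.before o₁ o ∧ P.att.before o₂ o :=
    fun o ho => ⟨hp₁₂ o ho o₁ (by simp), hp₁₂ o ho o₂ (by simp)⟩
  have hb : ∀ o ∈ m₂, P.att.before o o₁ ∧ P.att.before o o₂ :=
    fun o ho => ⟨hpo₁ o (by simp [ho]), hpo₂ o ho⟩
  have hcancel : cableMap K P = cableMap K (P.restrict fun o => o ≠ o₂ ∧ o ≠ o₁) := by
    refine hom_ext K fun D => ?_
    rw [cableMap_mk, cableMap_mk]
    convert cable_cancel K P o₂ o₁ ?_ ?_ hbef ?_ ?_ D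
    · exact (congrArg Prod.fst ho₂).trans (congrArg Prod.fst ho₁).symm
    · have h1 := congrArg Prod.snd ho₁
      have h2 := congrArg Prod.snd ho₂
      dsimp only at h1 h2
      rw [h1, h2, Bool.not_not]
    · intro o h2 h1
      constructor
      · intro h
        exact P.att.trans h hbef
      · intro h
        rcases hcase o ((P.att.arc_eq h).trans harc₁) h1 h2 with h' | h'
        · exact absurd (ha o h').1 (has _ _ h)
        · exact (hb o h').2
    · intro o h2 h1
      constructor
      · intro h
        rcases hcase o ((P.att.arc_eq h).symm.trans harc₂) h1 h2 with h' | h'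
        · exact (ha o h').1
        · exact absurd (hb o h').2 (has _ _ h)
      · intro h
        exact P.att.trans hbef h
  rw [hcancel]
  refine Realizes.cableMap_eq K ?_
  let L' : Fin n → List P.Pass := Function.update L j (m₁ ++ m₂)
  have hL' : ∀ i, ∀ o ∈ L' i, o ≠ o₂ ∧ o ≠ o₁ := by
    intro i o ho
    by_cases hi : i = j
    · subst hi
      simp only [L', Function.update_self, List.mem_append] at ho
      constructor
      · rintro rfl
        rcases ho with ho | ho
        · exact P.att.irrefl _ (ha _ ho).2
        · exact P.att.irrefl _ (hb _ ho).2
      · rintro rfl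
        rcases ho with ho | ho
        · exact P.att.irrefl _ (ha _ ho).1
        · exact P.att.irrefl _ (hb _ ho).1
    · simp only [L', Function.update_of_ne hi] at ho
      have := (hmem _ _).1 ho
      exact ⟨fun e => hi (by rw [← this, e, harc₂]), fun e => hi (by rw [← this, e, harc₁])⟩
  have h1 : ∀ i, ∀ o : {o // o ≠ o₂ ∧ o ≠ o₁},
      o ∈ (L' i).attachWith _ (hL' i) ↔ P.att.arc o.1 = i := by
    rintro i ⟨o, ho⟩
    rw [List.mem_attachWith]
    by_cases hi : i = j
    · subst hi
      simp only [L', Function.update_self, List.mem_append]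
      refine ⟨fun h => (hmem _ _).1 ?_, fun h => hcase o h ho.2 ho.1⟩
      rw [hm]
      simp only [List.mem_append, List.mem_cons]
      tauto
    · simp only [L', Function.update_of_ne hi, hmem]
  have h2 : ∀ i, ((L' i).attachWith _ (hL' i)).Pairwise fun o o' => P.att.before o'.1 o.1 := by
    intro i
    have : (L' i).Pairwise fun o o' => P.att.before o' o := by
      by_cases hi : i = j
      · subst hi
        simp only [L', Function.update_self, List.pairwise_append]
        exact ⟨hp₁, hp₂, fun o ho o' ho' => hp₁₂ o ho o' (by simp [ho'])⟩
      · simp only [L', Function.update_of_ne hi]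
        exact hpw i
    rw [← List.attachWith_map_subtype_val (hL' i), List.pairwise_map] at this
    exact this
  have h3 : ∀ i, ((L' i).attachWith _ (hL' i)).map (fun o => (P.src o.1, P.pos o.1)) =
      Function.update w j (l₁ ++ l₂) i := by
    intro i
    have : (L' i).map (fun o => (P.src o, P.pos o)) = Function.update w j (l₁ ++ l₂) i := by
      by_cases hi : i = j
      · subst hi
        simp [L', hm₁, hm₂]
      · simp [L', Function.update_of_ne hi, hmap]
    rw [← this]
    conv_rhs => rw [← List.attachWith_map_subtype_val (hL' i), List.map_map]
    rfl
  exact ⟨_, h1, h2, h3⟩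

theorem cableMap_red {m n : ℕ} (w : Fin n → List (Fin m × Bool)) (j : Fin n)
    (l : List (Fin m × Bool)) (h : FreeGroup.Red (w j) l) :
    cableMap K (strandsOfWords w) = cableMap K (strandsOfWords (Function.update w j l)) := by
  induction h with
  | refl => rw [Function.update_eq_self]
  | tail _ h ih =>
    rw [ih, (realizes_strandsOfWords _).step K j _ (by rwa [Function.update_self]),
      Function.update_idem]

theorem cableMap_reduce {m n : ℕ} (w : Fin n → List (Fin m × Bool)) :
    cableMap K (strandsOfWords w) = cableMap K (strandsOfWords fun j => FreeGroup.reduce (w j)) := by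
  have key : ∀ s : Finset (Fin n), cableMap K (strandsOfWords w) =
      cableMap K (strandsOfWords fun j => if j ∈ s then FreeGroup.reduce (w j) else w j) := by
    intro s
    induction s using Finset.induction_on with
    | empty => simp
    | insert j s hj ih =>
      rw [ih, cableMap_red K _ j (FreeGroup.reduce (w j)) (by
        simp only [if_neg hj]
        exact FreeGroup.reduce.red)]
      congr 2
      funext i
      by_cases hi : i = j
      · subst hi
        simp
      · simp [hi]
  simpa using key Finset.univ

theorem cableMap_congr {m n : ℕ} {w w' : Fin n → List (Fin m × Bool)}
    (h : ∀ j, FreeGroup.mk (w j) = FreeGroup.mk (w' j)) :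
    cableMap K (strandsOfWords w) = cableMap K (strandsOfWords w') := by
  rw [cableMap_reduce K w, cableMap_reduce K w']
  congr 2
  funext j
  exact FreeGroup.reduce.sound (h j)

/-- The strands of a homomorphism `f : F_n → F_m`, that is, of a homotopy class of maps
`X_n → U_m`: the `j`-th arc represents `f (x_j)`. The reduced words are used here; any other words
which represent the elements `f (x_j)` give the same linear map. -/
def strandsOfHom {m n : ℕ} (f : FreeGroup (Fin n) →* FreeGroup (Fin m)) : Strands m n :=
  strandsOfWords fun j => (f (FreeGroup.of j)).toWord

theorem cableMap_hom_comp {m n p : ℕ} (f : FreeGroup (Fin n) →* FreeGroup (Fin m))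
    (g : FreeGroup (Fin p) →* FreeGroup (Fin n)) :
    cableMap K (strandsOfHom (f.comp g)) =
      cableMap K (strandsOfHom g) ∘ₗ cableMap K (strandsOfHom f) := by
  rw [← cableMap_comp, strandsOfHom, strandsOfHom, strandsOfHom,
    ((realizes_strandsOfWords _).comp (realizes_strandsOfWords _)).cableMap_eq K]
  refine cableMap_congr K fun k => ?_
  rw [mk_substWord, FreeGroup.mk_toWord, FreeGroup.mk_toWord, MonoidHom.comp_apply]
  congr 1
  refine FreeGroup.ext_hom _ _ fun i => ?_
  simp [FreeGroup.mk_toWord]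

theorem cableMap_id (n : ℕ) :
    cableMap K (strandsOfHom (MonoidHom.id (FreeGroup (Fin n)))) = LinearMap.id := by
  have h : Realizes (⟨Fin n, id, fun _ => true,
      ⟨id, fun _ _ => False, False.elim, fun _ => id, fun h => h.elim, fun h h' => absurd h h'⟩⟩ :
      Strands n n) fun j => ((MonoidHom.id (FreeGroup (Fin n))) (FreeGroup.of j)).toWord :=
    ⟨fun j => [j], fun j o => by simp, fun j => by simp, fun j => by simp⟩
  rw [strandsOfHom, ← h.cableMap_eq K]
  refine hom_ext K fun D => ?_
  rw [cableMap_mk, cable, LinearMap.id_apply]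
  refine (Fintype.sum_eq_single (⟨D.att.arc, fun x => rfl⟩ : Lift _ D.att) ?_).trans ?_
  · intro φ hφ
    exact absurd (Lift.ext (funext fun x => φ.src_pass x)) hφ
  · have : liftAttachment _ D.att (⟨D.att.arc, fun x => rfl⟩ : Lift (⟨Fin n, id, fun _ => true,
      ⟨id, fun _ _ => False, False.elim, fun _ => id, fun h => h.elim, fun h h' => absurd h h'⟩⟩ :
      Strands n n) D.att) = D.att := by
      ext x y
      · rfl
      · simp only [liftAttachment, false_or, if_true]
        exact ⟨fun h => h.2, fun h => ⟨D.att.arc_eq h, h⟩⟩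
    rw [this]
    simp [liftSign]

theorem cableMap_mem {m n : ℕ} (P : Strands m n) (p : UniTriGraph → Prop) {x : JacobiSpace K m}
    (hx : x ∈ Submodule.span K {x | ∃ D : JacobiDiagram m, p D.graph ∧ mk K D = x}) :
    cableMap K P x ∈ Submodule.span K {x | ∃ D : JacobiDiagram n, p D.graph ∧ mk K D = x} := by
  refine (Submodule.span_le.2 ?_ : _ ≤ (Submodule.span K _).comap (cableMap K P)) hx
  rintro _ ⟨D, hD, rfl⟩
  rw [SetLike.mem_coe, Submodule.mem_comap, cableMap_mk]
  exact Submodule.sum_mem _ fun φ _ => Submodule.smul_mem _ _ (Submodule.subset_span ⟨_, hD, rfl⟩)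

theorem cableMap_mem_degreePart {m n : ℕ} (P : Strands m n) {d : ℕ} {x : JacobiSpace K m}
    (hx : x ∈ degreePart K d m) : cableMap K P x ∈ degreePart K d n :=
  cableMap_mem K P (fun G => Fintype.card G.Leg + Fintype.card G.Tri = 2 * d) hx

theorem cableMap_mem_filtrationPart {m n : ℕ} (P : Strands m n) {d k : ℕ} {x : JacobiSpace K m}
    (hx : x ∈ filtrationPart K d m k) : cableMap K P x ∈ filtrationPart K d n k := by
  have := cableMap_mem K P (x := x) (fun G => Fintype.card G.Leg + Fintype.card G.Tri = 2 * d ∧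
    k ≤ Fintype.card G.Tri)
  simp only [and_assoc] at this
  exact this hx

end Cabling

/-! ## The categories and the functor -/

/-- The category of finitely generated free groups: the object of rank `n` is the free group
`F_n = ⟨x_1, …, x_n⟩`, and morphisms are group homomorphisms. -/
structure FreeGrp where
  rank : ℕ

instance : Category FreeGrp where
  Hom a b := FreeGroup (Fin a.rank) →* FreeGroup (Fin b.rank)
  id a := MonoidHom.id _
  comp f g := g.comp f

/-- A filtered vector space: a vector space with a decreasing sequence of subspaces
`V = V_0 ⊇ V_1 ⊇ ⋯`. -/
structure FiltVect (K : Type u) [Field K] where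
  carrier : Type v
  [addCommGroup : AddCommGroup carrier]
  [module : Module K carrier]
  fil : ℕ → Submodule K carrier
  fil_zero : fil 0 = ⊤
  fil_antitone : Antitone fil

attribute [instance] FiltVect.addCommGroup FiltVect.module

/-- A linear map which preserves the filtrations. -/
@[ext]
structure FiltVect.Hom {K : Type u} [Field K] (V W : FiltVect.{u, v} K) where
  toLin : V.carrier →ₗ[K] W.carrier
  map_fil : ∀ k x, x ∈ V.fil k → toLin x ∈ W.fil k

instance (K : Type u) [Field K] : Category (FiltVect.{u, v} K) where
  Hom := FiltVect.Hom
  id V := ⟨LinearMap.id, fun _ _ h => h⟩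
  comp f g := ⟨g.toLin ∘ₗ f.toLin, fun k _ h => g.map_fil k _ (f.map_fil k _ h)⟩

/-- The functor forgetting the filtration. -/
def FiltVect.forget (K : Type u) [Field K] : FiltVect.{u, v} K ⥤ ModuleCat.{v} K where
  obj V := ModuleCat.of K V.carrier
  map f := ModuleCat.ofHom f.toLin

section Functor

variable (K : Type u) [Field K]

/-- The filtered vector space `A_d(n)`. -/
noncomputable def jacobiFiltVect (d n : ℕ) : FiltVect.{u, max u 1} K where
  carrier := degreePart K d n
  fil k := (filtrationPart K d n k).comap (degreePart K d n).subtype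
  fil_zero := by
    have : filtrationPart K d n 0 = degreePart K d n := by simp [filtrationPart, degreePart]
    rw [this, Submodule.comap_subtype_self]
  fil_antitone k l h := Submodule.comap_mono (Submodule.span_mono (by
    rintro _ ⟨D, hd, hk, rfl⟩
    exact ⟨D, hd, h.trans hk, rfl⟩))

/-- The functor `A_d` from the opposite of the category of finitely generated free groups to the
category of filtered vector spaces. -/
noncomputable def jacobiFunctor (d : ℕ) : FreeGrpᵒᵖ ⥤ FiltVect.{u, max u 1} K where
  obj n := jacobiFiltVect K d n.unop.rank
  map f :=
    { toLin := (cableMap K (strandsOfHom f.unop)).restrict fun _ h =>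
        cableMap_mem_degreePart K _ h
      map_fil := fun _ _ h => cableMap_mem_filtrationPart K _ h }
  map_id n := by
    refine FiltVect.Hom.ext (LinearMap.ext fun x => Subtype.ext ?_)
    exact LinearMap.congr_fun (cableMap_id K n.unop.rank) x.1
  map_comp f g := by
    refine FiltVect.Hom.ext (LinearMap.ext fun x => Subtype.ext ?_)
    exact LinearMap.congr_fun (cableMap_hom_comp K f.unop g.unop) x.1

/-- The right action `u · g = A_d(g)(u)` of `Aut(F_n)` on the filtered vector space `A_d(n)`. -/
noncomputable def autAction (d n : ℕ) :
    (MulAut (FreeGroup (Fin n)))ᵐᵒᵖ →* End (jacobiFiltVect K d n) where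
  toFun g := (jacobiFunctor K d).map
    (Quiver.Hom.op (X := (⟨n⟩ : FreeGrp)) (Y := ⟨n⟩) g.unop.toMonoidHom)
  map_one' := (jacobiFunctor K d).map_id (Opposite.op ⟨n⟩)
  map_mul' g h := (jacobiFunctor K d).map_comp
    (Quiver.Hom.op (X := (⟨n⟩ : FreeGrp)) (Y := ⟨n⟩) h.unop.toMonoidHom)
    (Quiver.Hom.op (X := (⟨n⟩ : FreeGrp)) (Y := ⟨n⟩) g.unop.toMonoidHom)

end Functor

/-- The group `Inn(G)` of inner automorphisms `x ↦ a x a⁻¹`. -/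
def Inn (G : Type*) [Group G] : Subgroup (MulAut G) := (MulAut.conj : G →* MulAut G).range

instance (G : Type*) [Group G] : (Inn G).Normal where
  conj_mem := by
    rintro _ ⟨a, rfl⟩ g
    exact ⟨g a, by ext x; simp⟩

/-- The outer automorphism group. -/
abbrev Out (G : Type*) [Group G] : Type _ := MulAut G ⧸ Inn G

/-- A contravariant functor from finitely generated free groups to vector spaces is an outer
functor if all inner automorphisms of all free groups `F_n` act trivially. -/
def IsOuterFunctor {K : Type u} [Field K] (F : FreeGrpᵒᵖ ⥤ ModuleCat.{v} K) : Prop :=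
  ∀ (n : ℕ) (g : MulAut (FreeGroup (Fin n))), g ∈ Inn (FreeGroup (Fin n)) →
    F.map (Quiver.Hom.op (X := (⟨n⟩ : FreeGrp)) (Y := ⟨n⟩) g.toMonoidHom) = 𝟙 _

end Jacobi

namespace Jacobi

/-! ## Chord diagrams -/

/-! Let `y` be an additional generator, the last one of `F_{n+1}`. Conjugation by `a` is `conjHom`,
`x_j ↦ y x_j y⁻¹`, followed by the homomorphism `F_{n+1} → F_n` which fixes the `x_j` and sends `y`
to `a`; the identity of `F_n` is `inclHom` followed by the same homomorphism. By functoriality it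
suffices that `conjHom` and `inclHom` induce the same map `A(n+1) → A(n)` (`cableMap_conjHom`), so
that no general word has to be cabled.

Connectedness of every component to a leg lets STU remove the trivalent vertices one by one, so the
two maps need only be compared on chord diagrams (`hom_ext_chord`). If no leg lies on the last arc,
the legs can only use the passages along the `x_j`, and both maps give the same sum. If some leg
does, `inclHom` gives an empty sum. For `conjHom`, consider the last leg on that arc. Every new arc
starts with a passage along `y⁻¹`, where the order is reversed, and ends with one along `y`, where
it is kept; so this leg becomes the very first point of an arc, with sign `-1`, or the very last
one, with sign `+1`. With the other legs fixed, the contributions are, up to a common sign, the sum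
over all arcs of "leg at the end" minus "leg at the beginning".

This difference vanishes (`sum_insertFirst_eq`). Moving the leg along an arc makes it cross the
other points `b` one at a time, and each crossing costs `commuteDiff b`; over all arcs, every other
point is crossed exactly once. The costs of the two ends of another chord cancel: by STU each is, up
to opposite signs, the diagram in which the moving chord is joined to the other one in a tripod
(`commuteDiff_add`, the four-term relation). Crossing the leg's own partner costs nothing, because
it only exchanges the names of the two adjacent ends of a chord (`commuteDiff_partner`). -/

/-- The graph with legs `Λ` and no trivalent vertices, whose edges are given by a fixed-point free
involution of `Λ`. -/
abbrev chordGraph {Λ : Type} [Fintype Λ] (σ : Λ → Λ) (hσ : Function.Involutive σ)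
    (hne : ∀ x, σ x ≠ x) : UniTriGraph where
  Leg := Λ
  Tri := Empty
  pair := Sum.map σ id
  pair_pair := by
    rintro (x | ⟨t, -⟩)
    · simp [hσ x]
    · exact t.elim
  pair_ne := by
    rintro (x | ⟨t, -⟩)
    · simpa using hne x
    · exact t.elim
  exists_leg := by
    rintro (x | ⟨t, -⟩)
    · exact ⟨x, .refl _⟩
    · exact t.elim

theorem mk_chordGraph_congr (K : Type u) [Field K] {n : ℕ} {Λ Λ' : Type} [Fintype Λ] [Fintype Λ']
    {σ : Λ → Λ} {hσ : Function.Involutive σ} {hne : ∀ x, σ x ≠ x} {σ' : Λ' → Λ'}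
    {hσ' : Function.Involutive σ'} {hne' : ∀ x, σ' x ≠ x} (e : Λ ≃ Λ')
    (he : ∀ x, σ' (e x) = e (σ x)) {α : Attachment n Λ} {α' : Attachment n Λ'}
    (harc : ∀ x, α'.arc (e x) = α.arc x)
    (hbefore : ∀ x y, α'.before (e x) (e y) ↔ α.before x y) :
    mk K ⟨chordGraph σ hσ hne, α⟩ = mk K ⟨chordGraph σ' hσ' hne', α'⟩ := by
  refine mk_eq_of_iso K ⟨e, Equiv.refl _, fun _ => 0, ?_, harc, hbefore⟩
  rintro (x | ⟨t, -⟩)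
  · exact congrArg Sum.inl (he x)
  · exact t.elim

open Classical in
/-- The pairing of the half-edges when the legs `p 0`, `p 1`, `p 2` are joined to a trivalent vertex
and the remaining legs are paired by `τ`. -/
noncomputable def tripodPair {Λ : Type} (τ : Λ → Λ) (p : Fin 3 → Λ) :
    HalfEdge Λ Unit → HalfEdge Λ Unit
  | Sum.inl x => if h : x ∈ Set.range p then Sum.inr ((), h.choose) else Sum.inl (τ x)
  | Sum.inr (_, i) => Sum.inl (p i)

theorem tripodPair_inr {Λ : Type} (τ : Λ → Λ) (p : Fin 3 → Λ) (t : Unit) (i : Fin 3) :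
    tripodPair τ p (Sum.inr (t, i)) = Sum.inl (p i) := rfl

theorem tripodPair_apply {Λ : Type} (τ : Λ → Λ) {p : Fin 3 → Λ} (hp : Function.Injective p)
    (i : Fin 3) : tripodPair τ p (Sum.inl (p i)) = Sum.inr ((), i) := by
  have h : p i ∈ Set.range p := ⟨i, rfl⟩
  simp only [tripodPair, h, dite_true]
  rw [hp h.choose_spec]

theorem tripodPair_of_notMem {Λ : Type} (τ : Λ → Λ) {p : Fin 3 → Λ} {x : Λ}
    (hx : x ∉ Set.range p) : tripodPair τ p (Sum.inl x) = Sum.inl (τ x) := by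
  simp only [tripodPair, hx, dite_false]

/-- The graph obtained from chords by joining the legs `p 0`, `p 1`, `p 2` to a trivalent vertex,
the remaining legs being paired by `τ`. -/
noncomputable abbrev tripodGraph {Λ : Type} [Fintype Λ] (τ : Λ → Λ) (p : Fin 3 → Λ)
    (hp : Function.Injective p) (hτ : ∀ x, x ∉ Set.range p → τ (τ x) = x ∧ τ x ≠ x ∧
      τ x ∉ Set.range p) : UniTriGraph where
  Leg := Λ
  Tri := Unit
  pair := tripodPair τ p
  pair_pair := by
    rintro (x | ⟨⟨⟩, i⟩)
    · by_cases h : x ∈ Set.range p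
      · obtain ⟨i, rfl⟩ := h
        rw [tripodPair_apply τ hp, tripodPair_inr]
      · rw [tripodPair_of_notMem τ h, tripodPair_of_notMem τ (hτ x h).2.2, (hτ x h).1]
    · rw [tripodPair_inr, tripodPair_apply τ hp]
  pair_ne := by
    rintro (x | ⟨⟨⟩, i⟩)
    · by_cases h : x ∈ Set.range p
      · obtain ⟨i, rfl⟩ := h
        rw [tripodPair_apply τ hp]
        exact Sum.inr_ne_inl
      · rw [tripodPair_of_notMem τ h]
        exact fun e => (hτ x h).2.1 (Sum.inl_injective e)
    · exact Sum.inl_ne_inr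
  exists_leg := by
    rintro (x | ⟨⟨⟩, i⟩)
    · exact ⟨x, .refl _⟩
    · exact ⟨p i, .rel _ _ (.edge (Sum.inr ((), i)))⟩

/-- Only the cyclic order at the trivalent vertex belongs to the data of a diagram. This identifies
the tripods obtained by resolving at two different legs in the four-term relation. -/
theorem mk_tripodGraph_rotate (K : Type u) [Field K] {n : ℕ} {Λ : Type} [Fintype Λ] {τ : Λ → Λ}
    {p q : Fin 3 → Λ} {hp : Function.Injective p} {hq : Function.Injective q}
    {hτ : ∀ x, x ∉ Set.range p → τ (τ x) = x ∧ τ x ≠ x ∧ τ x ∉ Set.range p}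
    {hτ' : ∀ x, x ∉ Set.range q → τ (τ x) = x ∧ τ x ≠ x ∧ τ x ∉ Set.range q}
    (β : Attachment n Λ) (c : Fin 3) (hqp : ∀ i, q (i + c) = p i) :
    mk K ⟨tripodGraph τ p hp hτ, β⟩ = mk K ⟨tripodGraph τ q hq hτ', β⟩ := by
  have key : ∀ h, tripodPair τ q (halfEdgeMap id id (fun _ => c) h) =
      halfEdgeMap id id (fun _ => c) (tripodPair τ p h) := by
    rintro (x | ⟨⟨⟩, i⟩)
    · by_cases h : x ∈ Set.range p
      · obtain ⟨i, rfl⟩ := h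
        rw [tripodPair_apply τ hp, ← hqp]
        exact tripodPair_apply τ hq _
      · have h' : x ∉ Set.range q := by
          rintro ⟨i, rfl⟩
          exact h ⟨i - c, by rw [← hqp, sub_add_cancel]⟩
        rw [tripodPair_of_notMem τ h]
        exact tripodPair_of_notMem τ h'
    · exact congrArg Sum.inl (hqp i)
  exact mk_eq_of_iso K ⟨Equiv.refl _, Equiv.refl _, fun _ => c, key, fun _ => rfl,
    fun _ _ => Iff.rfl⟩

/-! ## Inserting a point -/

/-- The attachment obtained from `β` by inserting a point on the arc `j`, just after the points of
the lower set `s`. -/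
def insertPoint {n : ℕ} {Λ : Type} (β : Attachment n Λ) (j : Fin n) (s : Λ → Prop)
    (hs : ∀ x y, β.before x y → s y → s x) : Attachment n (Option Λ) where
  arc x := x.elim j β.arc
  before x y := match x, y with
    | none, none => False
    | none, some y => β.arc y = j ∧ ¬ s y
    | some x, none => β.arc x = j ∧ s x
    | some x, some y => β.before x y
  arc_eq := by
    rintro (_ | x) (_ | y) h
    · rfl
    · exact h.1.symm
    · exact h.1
    · exact β.arc_eq h
  irrefl := by
    rintro (_ | x)
    · exact id
    · exact β.irrefl x
  trans := by
    rintro (_ | x) (_ | y) (_ | z) h k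
    · exact h
    · exact k
    · exact h.2 k.2
    · exact ⟨(β.arc_eq k).symm.trans h.1, fun hz => h.2 (hs _ _ k hz)⟩
    · exact h
    -- Here `x` lies in `s` and `z` does not. If `x` were not before `z`, then `z` would equal `x`
    -- or precede it, and would lie in the lower set `s`.
    · have e := β.arc_eq (x := x) (y := z)
      by_contra hxz
      rcases eq_or_ne x z with rfl | hne
      · exact k.2 h.2
      · exact (β.total (h.1.trans k.1.symm) hne).elim hxz fun h' => k.2 (hs _ _ h' h.2)
    · exact ⟨(β.arc_eq h).trans k.1, hs _ _ h k.2⟩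
    · exact β.trans h k
  total := by
    rintro (_ | x) (_ | y) h hne
    · exact absurd rfl hne
    · by_cases hy : s y
      · exact Or.inr ⟨h.symm, hy⟩
      · exact Or.inl ⟨h.symm, hy⟩
    · by_cases hx : s x
      · exact Or.inl ⟨h, hx⟩
      · exact Or.inr ⟨h, hx⟩
    · exact β.total h fun e => hne (congrArg some e)

theorem Attachment.asymm {n : ℕ} {Λ : Type} (β : Attachment n Λ) {x y : Λ} (h : β.before x y) :
    ¬ β.before y x := fun h' => β.irrefl _ (β.trans h h')

/-- Insertion of a point just before `b`. -/
def insertBefore {n : ℕ} {Λ : Type} (β : Attachment n Λ) (b : Λ) : Attachment n (Option Λ) :=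
  insertPoint β (β.arc b) (fun x => β.before x b) fun _ _ h h' => β.trans h h'

/-- Insertion of a point just after `b`. -/
def insertAfter {n : ℕ} {Λ : Type} (β : Attachment n Λ) (b : Λ) : Attachment n (Option Λ) :=
  insertPoint β (β.arc b) (fun x => x = b ∨ β.before x b) fun _ _ h h' =>
    Or.inr (h'.elim (fun e => e ▸ h) fun h' => β.trans h h')

/-- Insertion of a point at the beginning of the arc `j`. -/
def insertFirst {n : ℕ} {Λ : Type} (β : Attachment n Λ) (j : Fin n) : Attachment n (Option Λ) :=
  insertPoint β j (fun _ => False) fun _ _ _ h => h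

/-- Insertion of a point at the end of the arc `j`. -/
def insertLast {n : ℕ} {Λ : Type} (β : Attachment n Λ) (j : Fin n) : Attachment n (Option Λ) :=
  insertPoint β j (fun _ => True) fun _ _ _ h => h

/-- Exchange of insertion just before and just after a point, seen from a third point. -/
theorem insertAfter_before_iff {n : ℕ} {Λ : Type} (β : Attachment n Λ) (b : Λ) (x y : Option Λ)
    (h : x.getD b ≠ y.getD b) :
    (insertAfter β b).before x y ↔ (insertBefore β b).before x y := by
  rcases x with _ | x <;> rcases y with _ | y <;> simp_all [insertAfter, insertBefore, insertPoint]
  exact fun _ _ e => h e.symm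

/-- The new point is infinitely close to `b`, so points which `getD b` does not collapse to one
compare as their images do. This is the form required by `STU.before_glue`. -/
theorem insertBefore_before_iff {n : ℕ} {Λ : Type} (β : Attachment n Λ) (b : Λ) (x y : Option Λ)
    (h : x.getD b ≠ y.getD b) :
    β.before (x.getD b) (y.getD b) ↔ (insertBefore β b).before x y := by
  rcases x with _ | x <;> rcases y with _ | y <;>
    simp_all only [insertBefore, insertPoint, Option.getD_some, Option.getD_none, ne_eq,
      not_true_eq_false]
  · constructor
    · exact fun h' => ⟨(β.arc_eq h').symm, β.asymm h'⟩
    · exact fun h' => (β.total h'.1.symm h).resolve_right h'.2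
  · exact ⟨fun h' => ⟨β.arc_eq h', h'⟩, fun h' => h'.2⟩

theorem insertBefore_before_point {n : ℕ} {Λ : Type} (β : Attachment n Λ) (b : Λ) :
    (insertBefore β b).before none (some b) := ⟨rfl, β.irrefl b⟩

theorem insertAfter_before_point {n : ℕ} {Λ : Type} (β : Attachment n Λ) (b : Λ) :
    (insertAfter β b).before (some b) none := ⟨rfl, Or.inl rfl⟩

/-- The position of the new point depends only on the trace of the lower set on the arc `j`. -/
theorem insertPoint_congr {n : ℕ} {Λ : Type} (β : Attachment n Λ) {j : Fin n} {s s' : Λ → Prop}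
    {hs : ∀ x y, β.before x y → s y → s x} {hs' : ∀ x y, β.before x y → s' y → s' x}
    (h : ∀ x, β.arc x = j → (s x ↔ s' x)) : insertPoint β j s hs = insertPoint β j s' hs' := by
  ext x y
  · rfl
  · rcases x with _ | x <;> rcases y with _ | y
    · exact Iff.rfl
    · exact and_congr_right fun e => not_congr (h y e)
    · exact and_congr_right fun e => h x e
    · exact Iff.rfl

/-! ### The four-term relation, and moving a leg along the arcs -/

section FourTerm

variable (K : Type u) [Field K] {n : ℕ} {Λ : Type} {σ : Option Λ → Option Λ}

/-- The points `none`, `p 0`, `p 1`, `p 2` are exactly the ends of the chords at `a` and `b`. This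
set is stable under the involution `σ`, hence so is its complement. -/
theorem chord_of_notMem_tripod (hσ : Function.Involutive σ) {p : Fin 3 → Λ} {a b : Option Λ}
    (hab : a = none ∧ b = some (p 0) ∨ a = some (p 0) ∧ b = none) (ha : σ a = some (p 2))
    (hb : σ b = some (p 1)) {x : Λ} (hx : x ∉ Set.range p) :
    ∃ y, y ∉ Set.range p ∧ σ (some x) = some y ∧ σ (some y) = some x := by
  have hx0 : x ≠ p 0 := fun e => hx ⟨0, e.symm⟩
  have hxa : σ (some x) ≠ a := fun e => hx ⟨2, Option.some_injective _ (by rw [← ha, ← e, hσ])⟩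
  have hxb : σ (some x) ≠ b := fun e => hx ⟨1, Option.some_injective _ (by rw [← hb, ← e, hσ])⟩
  have hxn : σ (some x) ≠ none := by rcases hab with ⟨rfl, -⟩ | ⟨-, rfl⟩ <;> assumption
  have hx0' : σ (some x) ≠ some (p 0) := by rcases hab with ⟨-, rfl⟩ | ⟨rfl, -⟩ <;> assumption
  obtain ⟨y, hy⟩ := Option.ne_none_iff_exists'.1 hxn
  have hyx : σ (some y) = some x := by rw [← hy, hσ]
  refine ⟨y, ?_, hy, hyx⟩
  rintro ⟨i, rfl⟩
  fin_cases i
  · exact hx0' hy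
  · have : some x = b := by rw [← hyx]; exact (congrArg σ hb).symm.trans (hσ b)
    rcases hab with ⟨-, rfl⟩ | ⟨-, rfl⟩ <;> simp_all
  · have : some x = a := by rw [← hyx]; exact (congrArg σ ha).symm.trans (hσ a)
    rcases hab with ⟨rfl, -⟩ | ⟨rfl, -⟩ <;> simp_all

/-- The pairing which `σ` induces on the points other than `none`. -/
def restrictChords (σ : Option Λ → Option Λ) (x : Λ) : Λ := (σ (some x)).getD x

theorem restrictChords_tripod (hσ : Function.Involutive σ) (hne : ∀ x, σ x ≠ x) {p : Fin 3 → Λ}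
    {a b : Option Λ} (hab : a = none ∧ b = some (p 0) ∨ a = some (p 0) ∧ b = none)
    (ha : σ a = some (p 2)) (hb : σ b = some (p 1)) (x : Λ) (hx : x ∉ Set.range p) :
    restrictChords σ (restrictChords σ x) = x ∧ restrictChords σ x ≠ x ∧
      restrictChords σ x ∉ Set.range p := by
  obtain ⟨y, hy, hxy, hyx⟩ := chord_of_notMem_tripod hσ hab ha hb hx
  have e : restrictChords σ x = y := by rw [restrictChords, hxy, Option.getD_some]
  have e' : restrictChords σ y = x := by rw [restrictChords, hyx, Option.getD_some]
  rw [e, e']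
  exact ⟨rfl, fun e => hne _ (e ▸ hxy), hy⟩

/-- The STU relation which resolves the trivalent vertex of a tripod at its leg `p 0`. -/
theorem mk_chordGraph_sub [Fintype Λ] (hσ : Function.Involutive σ) (hne : ∀ x, σ x ≠ x)
    {p : Fin 3 → Λ} (hp : Function.Injective p)
    {a b : Option Λ} (hab : a = none ∧ b = some (p 0) ∨ a = some (p 0) ∧ b = none)
    (ha : σ a = some (p 2)) (hb : σ b = some (p 1)) (β : Attachment n Λ)
    {α α' : Attachment n (Option Λ)} (before_ab : α.before a b) (before_ba : α'.before b a)
    (arc_α : ∀ x, α.arc x = β.arc (x.getD (p 0))) (arc_α' : ∀ x, α'.arc x = β.arc (x.getD (p 0)))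
    (hα : ∀ x y, x.getD (p 0) ≠ y.getD (p 0) →
      (α.before x y ↔ β.before (x.getD (p 0)) (y.getD (p 0))))
    (hα' : ∀ x y, x.getD (p 0) ≠ y.getD (p 0) →
      (α'.before x y ↔ β.before (x.getD (p 0)) (y.getD (p 0)))) :
    mk K ⟨chordGraph σ hσ hne, α⟩ - mk K ⟨chordGraph σ hσ hne, α'⟩ =
      mk K ⟨tripodGraph (restrictChords σ) p hp (restrictChords_tripod hσ hne hab ha hb), β⟩ := by
  classical
  have hne_ab : a ≠ b := by rcases hab with ⟨rfl, rfl⟩ | ⟨rfl, rfl⟩ <;> simp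
  have hsa : ∀ i, i ≠ 0 → some (p i) ≠ a := by
    intro i hi
    rcases hab with ⟨rfl, rfl⟩ | ⟨rfl, rfl⟩ <;> simp [hp.eq_iff, hi]
  have hsb : ∀ i, i ≠ 0 → some (p i) ≠ b := by
    intro i hi
    rcases hab with ⟨rfl, rfl⟩ | ⟨rfl, rfl⟩ <;> simp [hp.eq_iff, hi]
  have hother : ∀ x : Option Λ, x ≠ a → x ≠ b → ∃ y, y ≠ p 0 ∧ x = some y := by
    intro x hxa hxb
    rcases x with _ | y
    · rcases hab with ⟨rfl, rfl⟩ | ⟨rfl, rfl⟩ <;> simp_all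
    · refine ⟨y, ?_, rfl⟩
      rintro rfl
      rcases hab with ⟨rfl, rfl⟩ | ⟨rfl, rfl⟩ <;> simp_all
  -- A chord diagram has no trivalent vertex, so the vertex created by gluing is the only one.
  let tri : Option Empty ≃ Unit := Equiv.ofUnique _ _
  let join := joinHalfEdge a b (fun x : Option Λ => x.getD (p 0)) tri
  have ja : join (Sum.inl a) = Sum.inr ((), 2) := by simp [join, joinHalfEdge]
  have jb : join (Sum.inl b) = Sum.inr ((), 1) := by simp [join, joinHalfEdge, hne_ab.symm]
  have jx : ∀ x : Λ, some x ≠ a → some x ≠ b → join (Sum.inl (some x)) = Sum.inl x := by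
    intro x h h'
    simp [join, joinHalfEdge, h, h']
  -- This is `STU.pair_join`. The ends at `a` and `b` become the half-edges 2 and 1 of the new
  -- vertex, which therefore lead to the former partners `p 2` and `p 1`; half-edge 0 leads to the
  -- glued leg `p 0`.
  have key : ∀ h, tripodPair (restrictChords σ) p (join h) = join (Sum.map σ id h) := by
    rintro (x | ⟨t, -⟩)
    · rw [Sum.map_inl]
      by_cases hxa : x = a
      · rw [hxa, ja, tripodPair_inr, ha, jx _ (hsa 2 (by decide)) (hsb 2 (by decide))]
      by_cases hxb : x = b
      · rw [hxb, jb, tripodPair_inr, hb, jx _ (hsa 1 (by decide)) (hsb 1 (by decide))]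
      obtain ⟨y, hy0, rfl⟩ := hother x hxa hxb
      rw [jx y hxa hxb]
      by_cases hy : y ∈ Set.range p
      · obtain ⟨i, rfl⟩ := hy
        rw [tripodPair_apply _ hp]
        fin_cases i
        · exact absurd rfl hy0
        · have : b = σ (some (p 1)) := by rw [← hb, hσ]
          exact jb.symm.trans (congrArg (fun z => join (Sum.inl z)) this)
        · have : a = σ (some (p 2)) := by rw [← ha, hσ]
          exact ja.symm.trans (congrArg (fun z => join (Sum.inl z)) this)
      · obtain ⟨z, hz, hyz, -⟩ := chord_of_notMem_tripod hσ hab ha hb hy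
        rw [tripodPair_of_notMem _ hy, hyz, restrictChords, hyz, Option.getD_some, jx]
        · rintro rfl
          exact hy ⟨2, Option.some_injective _ (by rw [← ha, ← hyz, hσ])⟩
        · rintro rfl
          exact hy ⟨1, Option.some_injective _ (by rw [← hb, ← hyz, hσ])⟩
    · exact t.elim
  have ga : a.getD (p 0) = p 0 := by rcases hab with ⟨rfl, rfl⟩ | ⟨rfl, rfl⟩ <;> rfl
  exact mk_stu K
    { a := a
      b := b
      glue := fun x : Option Λ => x.getD (p 0)
      tri := tri
      glue_surjective := fun x => ⟨some x, rfl⟩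
      glue_eq_iff := by
        rintro (_ | x) (_ | y) <;> rcases hab with ⟨rfl, rfl⟩ | ⟨rfl, rfl⟩ <;>
          simp [eq_comm]
      pair_join := key
      pair_new := by
        change tripodPair (restrictChords σ) p (Sum.inl (a.getD (p 0))) = _
        rw [ga, tripodPair_apply _ hp]
      before_ab := before_ab
      before_ba := before_ba
      arc_swap := fun x => by rw [arc_α, arc_α']
      before_swap := fun x y h => (hα' x y h).trans (hα x y h).symm
      arc_glue := fun x => (arc_α x).symm
      before_glue := fun x y h => (hα x y h).symm }

theorem insertBefore_arc (β : Attachment n Λ) (b : Λ) (x : Option Λ) :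
    (insertBefore β b).arc x = β.arc (x.getD b) := by
  rcases x with _ | x <;> rfl

theorem insertAfter_arc (β : Attachment n Λ) (b : Λ) (x : Option Λ) :
    (insertAfter β b).arc x = β.arc (x.getD b) := by
  rcases x with _ | x <;> rfl

variable [Fintype Λ]

/-- The effect of moving the point `none` from just after `b` to just before `b`. -/
noncomputable def commuteDiff (hσ : Function.Involutive σ) (hne : ∀ x, σ x ≠ x)
    (β : Attachment n Λ) (b : Λ) : JacobiSpace K n :=
  mk K ⟨chordGraph σ hσ hne, insertBefore β b⟩ - mk K ⟨chordGraph σ hσ hne, insertAfter β b⟩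

/-- The four-term relation. -/
theorem commuteDiff_add (hσ : Function.Involutive σ) (hne : ∀ x, σ x ≠ x) (β : Attachment n Λ)
    {b b' : Λ} (hb : σ (some b) = some b') :
    commuteDiff K hσ hne β b + commuteDiff K hσ hne β b' = 0 := by
  have hb' : σ (some b') = some b := by rw [← hb, hσ]
  obtain ⟨m, hm⟩ := Option.ne_none_iff_exists'.1 (hne none)
  have hbb' : b ≠ b' := fun e => hne _ (e ▸ hb)
  have hbm : b ≠ m := by
    rintro rfl
    rw [← hm, hσ] at hb
    exact Option.some_ne_none _ hb.symm
  have hb'm : b' ≠ m := by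
    rintro rfl
    rw [← hm, hσ] at hb'
    exact Option.some_ne_none _ hb'.symm
  -- `m` is the partner of the moving point. Crossing `b` costs the tripod whose legs are `b, b', m`
  -- in this cyclic order.
  have h1 := mk_chordGraph_sub K hσ hne (p := ![b, b', m]) (a := none) (b := some b)
    (by simp [Function.Injective, Fin.forall_fin_succ, hbb', hbm, hb'm, hbb'.symm, hbm.symm,
      hb'm.symm])
    (Or.inl ⟨rfl, rfl⟩) hm hb β (insertBefore_before_point β b) (insertAfter_before_point β b)
    (insertBefore_arc β b) (insertAfter_arc β b)
    (fun x y h => (insertBefore_before_iff β b x y h).symm)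
    (fun x y h => (insertAfter_before_iff β b x y h).trans (insertBefore_before_iff β b x y h).symm)
  -- At `b'` the diagrams are subtracted in the other order, with `some b'` before `none` first. The
  -- result is the tripod on `b', m, b`, which has the same cyclic order, so the two costs have
  -- opposite signs.
  have h2 := mk_chordGraph_sub K hσ hne (p := ![b', m, b]) (a := some b') (b := none)
    (by simp [Function.Injective, Fin.forall_fin_succ, hbb', hbm, hb'm, hbb'.symm, hbm.symm,
      hb'm.symm])
    (Or.inr ⟨rfl, rfl⟩) hb' hm β (insertAfter_before_point β b') (insertBefore_before_point β b')
    (insertAfter_arc β b') (insertBefore_arc β b')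
    (fun x y h =>
      (insertAfter_before_iff β b' x y h).trans (insertBefore_before_iff β b' x y h).symm)
    (fun x y h => (insertBefore_before_iff β b' x y h).symm)
  have h := h1.trans ((mk_tripodGraph_rotate K β 2 fun i => by fin_cases i <;> rfl).trans h2.symm)
  rw [commuteDiff, commuteDiff, h]
  abel

/-- The two ends of an isolated chord can be exchanged. -/
theorem commuteDiff_partner (hσ : Function.Involutive σ) (hne : ∀ x, σ x ≠ x)
    (β : Attachment n Λ) {m : Λ} (hm : σ none = some m) : commuteDiff K hσ hne β m = 0 := by
  classical
  have hm' : σ (some m) = none := by rw [← hm, hσ]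
  rw [commuteDiff, sub_eq_zero]
  -- Exchanging the two ends of the chord `{none, m}` preserves `σ` and turns "just before `m`" into
  -- "just after `m`".
  refine mk_chordGraph_congr K (Equiv.swap none (some m)) ?_ ?_ ?_
  · intro x
    rcases eq_or_ne x none with rfl | h1
    · simp [hm, hm']
    rcases eq_or_ne x (some m) with rfl | h2
    · simp [hm, hm']
    rw [Equiv.swap_apply_of_ne_of_ne h1 h2, Equiv.swap_apply_of_ne_of_ne]
    · intro e
      exact h2 (by rw [← hm, ← e, hσ])
    · intro e
      exact h1 (by rw [← hm', ← e, hσ])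
  · intro x
    rcases eq_or_ne x none with rfl | h1
    · simp [insertBefore_arc, insertAfter_arc]
    rcases eq_or_ne x (some m) with rfl | h2
    · simp [insertBefore_arc, insertAfter_arc]
    rw [Equiv.swap_apply_of_ne_of_ne h1 h2, insertBefore_arc, insertAfter_arc]
  · have hs : ∀ x : Option Λ, (Equiv.swap none (some m) x).getD m = x.getD m := by
      intro x
      rcases eq_or_ne x none with rfl | h1
      · simp
      rcases eq_or_ne x (some m) with rfl | h2
      · simp
      rw [Equiv.swap_apply_of_ne_of_ne h1 h2]
    intro x y
    by_cases h : x.getD m = y.getD m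
    · have hx : ∀ x : Option Λ, x.getD m = m → x = none ∨ x = some m := by
        rintro (_ | x) <;> simp
      by_cases hxm : x.getD m = m
      · rcases hx x hxm with rfl | rfl <;> rcases hx y (h ▸ hxm) with rfl | rfl <;>
          simp [insertBefore, insertAfter, insertPoint, β.irrefl]
      · have : x = y := by
          rcases x with _ | x <;> rcases y with _ | y <;> simp_all
        subst this
        exact iff_of_false (Attachment.irrefl _ _) (Attachment.irrefl _ _)
    · have h' : (Equiv.swap none (some m) x).getD m ≠ (Equiv.swap none (some m) y).getD m := by
        rwa [hs, hs]
      rw [insertAfter_before_iff _ _ _ _ h', ← insertBefore_before_iff _ _ _ _ h',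
        ← insertBefore_before_iff _ _ _ _ h, hs, hs]

/-- The terms at the two ends of a chord cancel by the four-term relation. The partner of `none` is
paired with itself, by the default value in `restrictChords`; this fixed point is harmless because
its term is zero. -/
theorem sum_commuteDiff (hσ : Function.Involutive σ) (hne : ∀ x, σ x ≠ x) (β : Attachment n Λ) :
    ∑ b, commuteDiff K hσ hne β b = 0 := by
  refine Finset.sum_involution (fun b _ => restrictChords σ b) ?_ ?_ (fun _ _ => Finset.mem_univ _)
    ?_
  · intro b _
    rcases h : σ (some b) with _ | b'
    · rw [restrictChords, h, Option.getD_none, commuteDiff_partner K hσ hne β (by rw [← h, hσ]),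
        add_zero]
    · rw [restrictChords, h, Option.getD_some, commuteDiff_add K hσ hne β h]
  · intro b _ hb e
    rcases h : σ (some b) with _ | b'
    · exact hb (commuteDiff_partner K hσ hne β (by rw [← h, hσ]))
    · rw [restrictChords, h, Option.getD_some] at e
      exact hne _ (e ▸ h)
  · intro b _
    rcases h : σ (some b) with _ | b'
    · simp [restrictChords, h]
    · have h' : σ (some b') = some b := by rw [← h, hσ]
      simp [restrictChords, h, h']

/-- A telescoping sum: crossing the points of the initial segment `T` one after the other carries
the moving point from the beginning of the arc to the place just after `T`. -/
theorem sum_commuteDiff_lower [DecidableEq Λ] (hσ : Function.Involutive σ) (hne : ∀ x, σ x ≠ x)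
    (β : Attachment n Λ) (j : Fin n) (T : Finset Λ) (harc : ∀ x ∈ T, β.arc x = j)
    (hT : ∀ x y, β.before x y → y ∈ T → x ∈ T) :
    ∑ b ∈ T, commuteDiff K hσ hne β b = mk K ⟨chordGraph σ hσ hne, insertFirst β j⟩ -
      mk K ⟨chordGraph σ hσ hne, insertPoint β j (· ∈ T) hT⟩ := by
  induction hc : T.card generalizing T with
  | zero =>
    obtain rfl := Finset.card_eq_zero.1 hc
    rw [Finset.sum_empty, eq_comm, sub_eq_zero, insertFirst,
      insertPoint_congr β (s := fun _ => False) (s' := (· ∈ (∅ : Finset Λ))) (hs' := hT)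
        fun x _ => by simp]
  | succ k ih =>
    -- Take the last point `b` of `T`. Then `T.erase b` is still an initial segment, insertion after
    -- it is insertion just before `b`, and insertion after `T` is insertion just after `b`.
    obtain ⟨b, hb, hmax⟩ := exists_extremal β true (T : Set Λ)
      (by rw [Finset.coe_nonempty, ← Finset.card_pos]; omega)
      fun x hx y hy => (harc x hx).trans (harc y hy).symm
    simp only [if_true, Finset.mem_coe] at hb hmax
    have hT' : ∀ x y, β.before x y → y ∈ T.erase b → x ∈ T.erase b := by
      intro x y h hy
      rw [Finset.mem_erase] at hy ⊢
      refine ⟨?_, hT _ _ h hy.2⟩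
      rintro rfl
      exact β.asymm h (hmax y hy.2 hy.1)
    obtain rfl := harc b hb
    rw [← Finset.add_sum_erase _ _ hb, ih (T.erase b)
      (fun x hx => harc x (Finset.mem_of_mem_erase hx)) hT'
      (by rw [Finset.card_erase_of_mem hb, hc]; rfl), commuteDiff, insertBefore, insertAfter,
      insertPoint_congr β (s := (· ∈ T.erase b)) (s' := fun x => β.before x b)
        (hs' := fun _ _ h h' => β.trans h h'),
      insertPoint_congr β (s := (· ∈ T)) (s' := fun x => x = b ∨ β.before x b)
        (hs' := fun _ _ h h' => Or.inr (h'.elim (fun e => e ▸ h) fun h' => β.trans h h'))]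
    · abel
    · intro x _
      refine ⟨fun hx => or_iff_not_imp_left.2 (hmax x hx), ?_⟩
      rintro (rfl | h)
      · exact hb
      · exact hT _ _ h hb
    · intro x _
      rw [Finset.mem_erase]
      refine ⟨fun hx => hmax x hx.2 hx.1, fun h => ⟨?_, hT _ _ h hb⟩⟩
      rintro rfl
      exact β.irrefl _ h

/-- The sum of all ways of attaching a leg at the beginning of an arc equals the sum of all ways of
attaching it at the end of an arc. -/
theorem sum_insertFirst_eq (hσ : Function.Involutive σ) (hne : ∀ x, σ x ≠ x)
    (β : Attachment n Λ) :
    ∑ j, mk K ⟨chordGraph σ hσ hne, insertFirst β j⟩ =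
      ∑ j, mk K ⟨chordGraph σ hσ hne, insertLast β j⟩ := by
  classical
  -- The zero on the right is replaced by the sum of all `commuteDiff`, split according to the arcs.
  -- The part on the arc `j` telescopes to the difference of the two extreme positions.
  rw [← sub_eq_zero, ← Finset.sum_sub_distrib, ← sum_commuteDiff K hσ hne β,
    ← Finset.sum_fiberwise Finset.univ β.arc]
  refine Finset.sum_congr rfl fun j _ => ?_
  have hT : ∀ x y, β.before x y → y ∈ Finset.univ.filter (β.arc · = j) →
      x ∈ Finset.univ.filter (β.arc · = j) := fun x y h hy => by simpa [β.arc_eq h] using hy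
  rw [sum_commuteDiff_lower K hσ hne β j _ (fun x hx => (Finset.mem_filter.1 hx).2) hT, insertLast,
    insertPoint_congr β (s := fun _ => True) (hs' := hT) fun x hx => by simp [hx]]

end FourTerm
/-! ## Chord diagrams span -/

/-- Otherwise edges would join legs only to legs and trivalent vertices only to trivalent vertices,
so no path could lead from `t₀` to a leg. -/
theorem UniTriGraph.exists_pair_eq_inr (G : UniTriGraph) (t₀ : G.Tri) :
    ∃ (l : G.Leg) (t : G.Tri) (i : Fin 3), G.pair (Sum.inl l) = Sum.inr (t, i) := by
  by_contra! hno
  have key : ∀ h h', Linked G.pair h h' → (h.isLeft = h'.isLeft) := by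
    rintro h _ (- | ⟨t, i, j⟩)
    · rcases h with l | ⟨t, i⟩
      · rcases h' : G.pair (Sum.inl l) with l' | ⟨t, i⟩
        · rfl
        · exact absurd h' (hno l t i)
      · rcases h' : G.pair (Sum.inr (t, i)) with l | ⟨t', i'⟩
        · exact absurd (by rw [← h', G.pair_pair]) (hno l t i)
        · rfl
    · rfl
  have key' : ∀ h h', Relation.EqvGen (Linked G.pair) h h' → (h.isLeft = h'.isLeft) := by
    intro h h' r
    induction r with
    | rel _ _ r => exact key _ _ r
    | refl _ => rfl
    | symm _ _ _ ih => exact ih.symm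
    | trans _ _ _ _ _ ih ih' => exact ih.trans ih'
  obtain ⟨l, hl⟩ := G.exists_leg (Sum.inr (t₀, 0))
  exact Bool.false_ne_true (key' _ _ hl)

/-- Rotation of the half-edges at every trivalent vertex. -/
def rotateHalfEdge {Leg Tri : Type} (c : Fin 3) : HalfEdge Leg Tri → HalfEdge Leg Tri :=
  halfEdgeMap id id fun _ => c

theorem rotateHalfEdge_rotateHalfEdge {Leg Tri : Type} (c c' : Fin 3) (h : HalfEdge Leg Tri) :
    rotateHalfEdge c (rotateHalfEdge c' h) = rotateHalfEdge (c' + c) h := by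
  rcases h with l | ⟨t, i⟩
  · rfl
  · exact congrArg (fun j => Sum.inr (t, j)) (add_assoc i c' c)

theorem rotateHalfEdge_zero {Leg Tri : Type} (h : HalfEdge Leg Tri) :
    rotateHalfEdge 0 h = h := by
  rcases h with l | ⟨t, i⟩
  · rfl
  · exact congrArg (fun j => Sum.inr (t, j)) (add_zero i)

/-- The same graph with another numbering of the half-edges at the trivalent vertices. -/
abbrev UniTriGraph.rotate (G : UniTriGraph) (c : Fin 3) : UniTriGraph where
  Leg := G.Leg
  Tri := G.Tri
  pair h := rotateHalfEdge c (G.pair (rotateHalfEdge (-c) h))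
  pair_pair h := by
    rw [rotateHalfEdge_rotateHalfEdge, add_neg_cancel, rotateHalfEdge_zero, G.pair_pair,
      rotateHalfEdge_rotateHalfEdge, neg_add_cancel, rotateHalfEdge_zero]
  pair_ne h e := by
    refine G.pair_ne (rotateHalfEdge (-c) h) ?_
    conv_rhs => rw [← e, rotateHalfEdge_rotateHalfEdge, add_neg_cancel, rotateHalfEdge_zero]
  exists_leg h := by
    have key : ∀ x y, Relation.EqvGen (Linked G.pair) x y →
        Relation.EqvGen (Linked fun h => rotateHalfEdge c (G.pair (rotateHalfEdge (-c) h)))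
          (rotateHalfEdge c x) (rotateHalfEdge c y) := by
      intro x y r
      induction r with
      | rel h _ r =>
        refine .rel _ _ ?_
        rcases r with - | ⟨t, i, j⟩
        · have := Linked.edge (pair := fun h => rotateHalfEdge c (G.pair (rotateHalfEdge (-c) h)))
            (rotateHalfEdge c h)
          rwa [rotateHalfEdge_rotateHalfEdge, add_neg_cancel, rotateHalfEdge_zero] at this
        · exact .vertex t (i + c) (j + c)
      | refl _ => exact .refl _
      | symm _ _ _ ih => exact .symm _ _ ih
      | trans _ _ _ _ _ ih ih' => exact .trans _ _ _ ih ih'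
    obtain ⟨l, hl⟩ := G.exists_leg (rotateHalfEdge (-c) h)
    have := key _ _ hl
    rw [rotateHalfEdge_rotateHalfEdge, neg_add_cancel, rotateHalfEdge_zero] at this
    exact ⟨l, this⟩

/-- Isomorphisms of diagrams may rotate the numbering at the trivalent vertices. This allows one to
assume that a given leg is joined to the half-edge 0, as `STU` demands. -/
theorem mk_rotate (K : Type u) [Field K] {n : ℕ} (G : UniTriGraph) (α : Attachment n G.Leg)
    (c : Fin 3) : mk K ⟨G, α⟩ = mk K ⟨G.rotate c, α⟩ := by
  have key : ∀ h, rotateHalfEdge c (G.pair (rotateHalfEdge (-c) (rotateHalfEdge c h))) =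
      rotateHalfEdge c (G.pair h) := by
    intro h
    rw [rotateHalfEdge_rotateHalfEdge, add_neg_cancel, rotateHalfEdge_zero]
  exact mk_eq_of_iso K ⟨Equiv.refl _, Equiv.refl _, fun _ => c, key, fun _ => rfl,
    fun _ _ => Iff.rfl⟩

/-! ### Splitting a trivalent vertex adjacent to a leg -/

section Unjoin

open Classical in
/-- The half-edges which remain when the trivalent vertex `t`, linked by its half-edge `0` to the
leg `l`, is split into the two legs `none` and `some l`. -/
noncomputable def unjoinMap {Leg Tri : Type} (l : Leg) (t : Tri) :
    HalfEdge (Option Leg) {t' // t' ≠ t} → HalfEdge Leg Tri :=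
  joinHalfEdge none (some l) (fun x => x.getD l) (Equiv.optionSubtypeNe t)

variable {Leg Tri : Type} (l : Leg) (t : Tri)

theorem unjoinMap_none : unjoinMap l t (Sum.inl none) = Sum.inr (t, 2) := by
  simp [unjoinMap, joinHalfEdge]

theorem unjoinMap_some_self : unjoinMap l t (Sum.inl (some l)) = Sum.inr (t, 1) := by
  simp [unjoinMap, joinHalfEdge]

theorem unjoinMap_some {x : Leg} (h : x ≠ l) : unjoinMap l t (Sum.inl (some x)) = Sum.inl x := by
  simp [unjoinMap, joinHalfEdge, h]

theorem unjoinMap_inr (t' : {t' // t' ≠ t}) (i : Fin 3) :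
    unjoinMap l t (Sum.inr (t', i)) = Sum.inr (t'.1, i) := by
  simp [unjoinMap, joinHalfEdge]

/-- Together with `exists_unjoinMap_eq` and `unjoinMap_injective`, this makes `unjoinMap` a
bijection onto the half-edges outside the edge between `l` and `t`. Since the pairing exchanges the
two halves of that edge, it restricts to the others and can be transported to the split graph. -/
theorem unjoinMap_ne (h : HalfEdge (Option Leg) {t' // t' ≠ t}) :
    unjoinMap l t h ≠ Sum.inl l ∧ unjoinMap l t h ≠ Sum.inr (t, 0) := by
  rcases h with (_ | x) | ⟨t', i⟩
  · simp [unjoinMap_none]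
  · by_cases h : x = l
    · simp [h, unjoinMap_some_self]
    · simp [unjoinMap_some l t h, h]
  · simp [unjoinMap_inr, t'.2]

theorem exists_unjoinMap_eq (h : HalfEdge Leg Tri) (h1 : h ≠ Sum.inl l) (h2 : h ≠ Sum.inr (t, 0)) :
    ∃ g, unjoinMap l t g = h := by
  rcases h with x | ⟨t', i⟩
  · exact ⟨_, unjoinMap_some l t fun e => h1 (congrArg Sum.inl e)⟩
  · by_cases e : t' = t
    · subst e
      fin_cases i
      · exact absurd rfl h2
      · exact ⟨_, unjoinMap_some_self l t'⟩
      · exact ⟨_, unjoinMap_none l t'⟩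
    · exact ⟨_, unjoinMap_inr l t ⟨t', e⟩ i⟩

theorem unjoinMap_injective : Function.Injective (unjoinMap l t) := by
  have h12 : (1 : Fin 3) ≠ 2 := by decide
  have h21 : (2 : Fin 3) ≠ 1 := by decide
  rintro ((_ | x) | ⟨t', i⟩) ((_ | y) | ⟨t'', i'⟩) h
  · rfl
  · by_cases hy : y = l
    · subst hy
      simp [unjoinMap_none, unjoinMap_some_self, h21] at h
    · simp [unjoinMap_none, unjoinMap_some l t hy] at h
  · simp [unjoinMap_none, unjoinMap_inr, t''.2.symm] at h
  · by_cases hx : x = l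
    · subst hx
      simp [unjoinMap_none, unjoinMap_some_self, h12] at h
    · simp [unjoinMap_none, unjoinMap_some l t hx] at h
  · by_cases hx : x = l <;> by_cases hy : y = l
    · rw [hx, hy]
    · simp [hx, unjoinMap_some_self, unjoinMap_some l t hy] at h
    · simp [hy, unjoinMap_some_self, unjoinMap_some l t hx] at h
    · rw [unjoinMap_some l t hx, unjoinMap_some l t hy] at h
      rw [Sum.inl_injective h]
  · by_cases hx : x = l
    · simp [hx, unjoinMap_some_self, unjoinMap_inr, t''.2.symm] at h
    · simp [unjoinMap_some l t hx, unjoinMap_inr] at h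
  · simp [unjoinMap_none, unjoinMap_inr, t'.2] at h
  · by_cases hx : y = l
    · simp [hx, unjoinMap_some_self, unjoinMap_inr, t'.2] at h
    · simp [unjoinMap_some l t hx, unjoinMap_inr] at h
  · rw [unjoinMap_inr, unjoinMap_inr] at h
    have := Sum.inr_injective h
    rw [Prod.mk.injEq] at this
    rw [Subtype.ext this.1, this.2]

end Unjoin

/-- The gluing in `STU` is undone: delete `t` and its edge to `l`, and let its half-edges 2 and 1
end in the adjacent legs `none` and `some l`. The two orders of these legs give the two resolved
diagrams. -/
theorem exists_stu_of_pair {n : ℕ} (S : JacobiDiagram n) (l : S.graph.Leg) (t : S.graph.Tri)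
    (hl : S.graph.pair (Sum.inl l) = Sum.inr (t, 0)) :
    ∃ (G : UniTriGraph) (α α' : Attachment n G.Leg), Nonempty (STU G α α' S) ∧
      Fintype.card G.Tri + 1 = Fintype.card S.graph.Tri := by
  classical
  have hl' : S.graph.pair (Sum.inr (t, 0)) = Sum.inl l := by rw [← hl, S.graph.pair_pair]
  have hex : ∀ h : HalfEdge (Option S.graph.Leg) {t' // t' ≠ t},
      ∃ g, unjoinMap l t g = S.graph.pair (unjoinMap l t h) := by
    intro h
    have hh := unjoinMap_ne l t h
    refine exists_unjoinMap_eq l t _ (fun e => hh.2 ?_) fun e => hh.1 ?_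
    · rw [← hl, ← e, S.graph.pair_pair]
    · rw [← hl', ← e, S.graph.pair_pair]
  choose pair hpair using hex
  -- Needed for the existence of a leg in every component of the split graph. The property "deleted,
  -- or connected to a leg after the splitting" is invariant along paths in the old graph.
  have hleg : ∀ h h', Relation.EqvGen (Linked S.graph.pair) h h' →
      (((h = Sum.inl l ∨ h = Sum.inr (t, 0)) ∨ ∃ g, unjoinMap l t g = h ∧
        ∃ x, Relation.EqvGen (Linked pair) g (Sum.inl x)) ↔
      ((h' = Sum.inl l ∨ h' = Sum.inr (t, 0)) ∨ ∃ g, unjoinMap l t g = h' ∧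
        ∃ x, Relation.EqvGen (Linked pair) g (Sum.inl x))) := by
    -- A path may pass through `t`, but each of the half-edges there has the property: 0 is deleted,
    -- while 1 and 2 have become legs.
    have hvert : ∀ i : Fin 3, ((Sum.inr (t, i) : HalfEdge S.graph.Leg S.graph.Tri) = Sum.inl l ∨
        (Sum.inr (t, i) : HalfEdge S.graph.Leg S.graph.Tri) = Sum.inr (t, 0)) ∨
        ∃ g, unjoinMap l t g = Sum.inr (t, i) ∧
          ∃ x, Relation.EqvGen (Linked pair) g (Sum.inl x) := by
      intro i
      fin_cases i
      · exact Or.inl (Or.inr rfl)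
      · exact Or.inr ⟨_, unjoinMap_some_self l t, _, .refl _⟩
      · exact Or.inr ⟨_, unjoinMap_none l t, _, .refl _⟩
    have hedge : ∀ h : HalfEdge S.graph.Leg S.graph.Tri,
        ((h = Sum.inl l ∨ h = Sum.inr (t, 0)) ∨ ∃ g, unjoinMap l t g = h ∧
          ∃ x, Relation.EqvGen (Linked pair) g (Sum.inl x)) →
        ((S.graph.pair h = Sum.inl l ∨ S.graph.pair h = Sum.inr (t, 0)) ∨
          ∃ g, unjoinMap l t g = S.graph.pair h ∧
            ∃ x, Relation.EqvGen (Linked pair) g (Sum.inl x)) := by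
      rintro h ((rfl | rfl) | ⟨g, rfl, x, hx⟩)
      · exact Or.inl (Or.inr hl)
      · exact Or.inl (Or.inl hl')
      · exact Or.inr ⟨pair g, hpair g, x, .trans _ _ _ (.symm _ _ (.rel _ _ (.edge g))) hx⟩
    have hother : ∀ t' i j, t' ≠ t → (∃ g, unjoinMap l t g = Sum.inr (t', i) ∧
          ∃ x, Relation.EqvGen (Linked pair) g (Sum.inl x)) →
        ∃ g, unjoinMap l t g = Sum.inr (t', j) ∧
          ∃ x, Relation.EqvGen (Linked pair) g (Sum.inl x) := by
      rintro t' i j ht ⟨g, hg, x, hx⟩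
      obtain rfl := unjoinMap_injective l t (hg.trans (unjoinMap_inr l t ⟨t', ht⟩ i).symm)
      exact ⟨Sum.inr (⟨t', ht⟩, j), unjoinMap_inr l t ⟨t', ht⟩ j, x,
        .trans _ _ _ (.rel _ _ (.vertex _ j i)) hx⟩
    intro h h' r
    induction r with
    | rel h _ r =>
      rcases r with - | ⟨t', i, j⟩
      · refine ⟨hedge h, fun H => ?_⟩
        have := hedge _ H
        rwa [S.graph.pair_pair] at this
      · by_cases ht : t' = t
        · subst ht
          exact iff_of_true (hvert i) (hvert j)
        · simp only [reduceCtorEq, Sum.inr.injEq, Prod.mk.injEq, ht, false_and, or_self, false_or]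
          exact ⟨hother t' i j ht, hother t' j i ht⟩
    | refl _ => exact Iff.rfl
    | symm _ _ _ ih => exact ih.symm
    | trans _ _ _ _ _ ih ih' => exact ih.trans ih'
  let G : UniTriGraph :=
    { Leg := Option S.graph.Leg
      Tri := {t' // t' ≠ t}
      pair := pair
      pair_pair := fun h => unjoinMap_injective l t (by rw [hpair, hpair, S.graph.pair_pair])
      pair_ne := fun h e => S.graph.pair_ne (unjoinMap l t h) (by rw [← hpair, e])
      exists_leg := by
        intro h
        have hh := unjoinMap_ne l t h
        obtain ⟨x, hx⟩ := S.graph.exists_leg (unjoinMap l t h)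
        have hx' : ((Sum.inl x : HalfEdge S.graph.Leg S.graph.Tri) = Sum.inl l ∨
            (Sum.inl x : HalfEdge S.graph.Leg S.graph.Tri) = Sum.inr (t, 0)) ∨
            ∃ g, unjoinMap l t g = Sum.inl x ∧
              ∃ x, Relation.EqvGen (Linked pair) g (Sum.inl x) := by
          by_cases e : x = l
          · exact Or.inl (Or.inl (congrArg Sum.inl e))
          · exact Or.inr ⟨_, unjoinMap_some l t e, _, .refl _⟩
        rcases (hleg _ _ hx).2 hx' with h' | ⟨g, hg, hg'⟩
        · exact absurd h' (not_or.2 hh)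
        · rwa [unjoinMap_injective l t hg] at hg' }
  refine ⟨G, insertBefore S.att l, insertAfter S.att l,
    ⟨{a := none
      b := some l
      glue := fun x => x.getD l
      tri := Equiv.optionSubtypeNe t
      glue_surjective := fun x => ⟨some x, rfl⟩
      glue_eq_iff := by rintro (_ | x) (_ | y) <;> simp [eq_comm, G]
      pair_join := fun h => (hpair h).symm
      pair_new := by
        rw [Equiv.optionSubtypeNe_none]
        exact hl
      before_ab := insertBefore_before_point _ _
      before_ba := insertAfter_before_point _ _
      arc_swap := fun x => (insertAfter_arc _ _ x).trans (insertBefore_arc _ _ x).symm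
      before_swap := fun x y h => insertAfter_before_iff _ _ x y h
      arc_glue := fun x => (insertBefore_arc _ _ x).symm
      before_glue := fun x y h => insertBefore_before_iff _ _ x y h }⟩, ?_⟩
  have := Fintype.card_congr (Equiv.optionSubtypeNe t)
  rwa [Fintype.card_option] at this

/-- Linear maps which agree on all chord diagrams are equal. -/
theorem hom_ext_chord (K : Type u) [Field K] {m : ℕ} {W : Type*} [AddCommGroup W] [Module K W]
    {f g : JacobiSpace K m →ₗ[K] W}
    (h : ∀ (Λ : Type) [Fintype Λ] (σ : Λ → Λ) (hσ : Function.Involutive σ) (hne : ∀ x, σ x ≠ x)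
      (α : Attachment m Λ), f (mk K ⟨chordGraph σ hσ hne, α⟩) = g (mk K ⟨chordGraph σ hσ hne, α⟩)) :
    f = g := by
  -- Induction on the number of trivalent vertices: STU expresses a diagram as a difference of two
  -- diagrams with one vertex less.
  have key : ∀ (k : ℕ) (D : JacobiDiagram m), Fintype.card D.graph.Tri = k →
      f (mk K D) = g (mk K D) := by
    intro k
    induction k with
    | zero =>
      intro D hD
      have hemp : IsEmpty D.graph.Tri := Fintype.card_eq_zero_iff.1 hD
      have hex : ∀ x, ∃ y, D.graph.pair (Sum.inl x) = Sum.inl y := by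
        intro x
        rcases D.graph.pair (Sum.inl x) with y | ⟨t, i⟩
        · exact ⟨y, rfl⟩
        · exact hemp.elim t
      choose σ hpair using hex
      have hσ : Function.Involutive σ := fun x => Sum.inl_injective (by
        rw [← hpair, ← hpair, D.graph.pair_pair])
      have hne : ∀ x, σ x ≠ x := fun x e => D.graph.pair_ne (Sum.inl x) (by rw [hpair, e])
      have e : mk K D = mk K ⟨chordGraph σ hσ hne, D.att⟩ := by
        refine mk_eq_of_iso K ⟨Equiv.refl _, Equiv.equivOfIsEmpty _ _, fun _ => 0, ?_,
          fun _ => rfl, fun _ _ => Iff.rfl⟩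
        rintro (x | ⟨t, -⟩)
        · rw [hpair]
          rfl
        · exact hemp.elim t
      rw [e]
      exact h _ _ _ _ _
    | succ k ih =>
      intro D hD
      have hne : Nonempty D.graph.Tri := Fintype.card_pos_iff.1 (by omega)
      obtain ⟨l, t, i, hl⟩ := D.graph.exists_pair_eq_inr hne.some
      -- Rotation by `-i` brings the half-edge joined to `l` to the number 0.
      have hl' : (D.graph.rotate (-i)).pair (Sum.inl l) = Sum.inr (t, 0) := by
        change rotateHalfEdge (-i) (D.graph.pair (Sum.inl l)) = _
        rw [hl]
        exact congrArg (fun j => Sum.inr (t, j)) (add_neg_cancel i)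
      obtain ⟨G, α, α', ⟨s⟩, hG⟩ := exists_stu_of_pair ⟨D.graph.rotate (-i), D.att⟩ l t hl'
      have hG' : Fintype.card G.Tri = k := by
        have : Fintype.card (D.graph.rotate (-i)).Tri = k + 1 := hD
        change Fintype.card G.Tri + 1 = Fintype.card (D.graph.rotate (-i)).Tri at hG
        omega
      have e : mk K D = _ := mk_rotate K D.graph D.att (-i)
      rw [e, ← mk_stu K s, map_sub, map_sub, ih ⟨G, α⟩ hG', ih ⟨G, α'⟩ hG']
  exact hom_ext K fun D => key _ D rfl

/-! ## Conjugation by an additional generator -/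

/-- Relabelling of the points along an injection. -/
def Attachment.comap {n : ℕ} {Λ Λ' : Type} (α : Attachment n Λ) (f : Λ' → Λ)
    (hf : Function.Injective f) : Attachment n Λ' where
  arc x := α.arc (f x)
  before x y := α.before (f x) (f y)
  arc_eq h := α.arc_eq h
  irrefl _ := α.irrefl _
  trans h h' := α.trans h h'
  total h hne := α.total h (hf.ne hne)

/-- The strands of `x_j ↦ y x_j y⁻¹`, where `y` is the last generator of `F_{n+1}`. -/
def conjStrands (n : ℕ) : Strands (n + 1) n where
  Pass := Fin n × Fin 3
  -- The last letter of `y x_j y⁻¹` is passed first: the passages 0, 1, 2 run along `y⁻¹`, `x_j`,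
  -- `y`, and only the passage 0 is negative.
  src o := if o.2 = 1 then o.1.castSucc else Fin.last n
  pos o := decide (o.2 ≠ 0)
  att :=
    { arc := fun o => o.1
      before := fun o o' => o.1 = o'.1 ∧ o.2 < o'.2
      arc_eq := fun h => h.1
      irrefl := fun o h => lt_irrefl _ h.2
      trans := fun h h' => ⟨h.1.trans h'.1, h.2.trans h'.2⟩
      total := by
        rintro ⟨j, i⟩ ⟨j', i'⟩ rfl hne
        have : i ≠ i' := fun e => hne (by rw [e])
        exact (lt_or_gt_of_ne this).imp (fun h => ⟨rfl, h⟩) fun h => ⟨rfl, h⟩ }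

/-- The strands of the inclusion `F_n → F_{n+1}`. -/
def inclStrands (n : ℕ) : Strands (n + 1) n where
  Pass := Fin n
  src := Fin.castSucc
  pos _ := true
  att := ⟨id, fun _ _ => False, False.elim, fun _ => id, fun h => h.elim,
    fun h h' => absurd h h'⟩

theorem conjStrands_src_eq_last {n : ℕ} (o : (conjStrands n).Pass) :
    (conjStrands n).src o = Fin.last n ↔ o.2 ≠ 1 := by
  by_cases h : o.2 = 1
  · simp [conjStrands, h, Fin.castSucc_ne_last]
  · simp [conjStrands, h]

/-- The end of the `j`-th strand at which it passes along `y`. -/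
def conjEnd {n : ℕ} (j : Fin n) (b : Bool) : (conjStrands n).Pass := (j, if b then 2 else 0)

/-! ### Cabling when a leg lies on the additional arc -/

section Option

variable {n : ℕ} {Λ : Type} (α : Attachment (n + 1) (Option Λ))

/-- To move the legs, move first all legs but `none`, which lies on the last arc. -/
def liftOptionEquiv (harc : α.arc none = Fin.last n) :
    (Fin n × Bool) × Lift (conjStrands n) (α.comap some (Option.some_injective Λ)) ≃
      Lift (conjStrands n) α where
  toFun p := ⟨fun x => x.elim (conjEnd p.1.1 p.1.2) p.2.pass, by
    rintro (_ | x)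
    · rw [harc, conjStrands_src_eq_last]
      rcases p with ⟨⟨j, _ | _⟩, ψ⟩
      · exact (by decide : (0 : Fin 3) ≠ 1)
      · exact (by decide : (2 : Fin 3) ≠ 1)
    · exact p.2.src_pass x⟩
  invFun φ := (((φ.pass none).1, decide ((φ.pass none).2 = 2)),
    ⟨fun x => φ.pass (some x), fun x => φ.src_pass (some x)⟩)
  left_inv := by
    rintro ⟨⟨j, _ | _⟩, ψ⟩ <;> rfl
  right_inv φ := by
    refine Lift.ext (funext fun x => ?_)
    rcases x with _ | x
    · have h := φ.src_pass none
      rw [harc, conjStrands_src_eq_last] at h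
      change conjEnd (φ.pass none).1 (decide ((φ.pass none).2 = 2)) = φ.pass none
      generalize φ.pass none = o at h ⊢
      obtain ⟨j, i⟩ := o
      fin_cases i
      · rfl
      · exact absurd rfl h
      · rfl
    · rfl

/-- The leg `none` is the last one on the arc of `y`. The passage 2 is positive, so `none` stays
last on it, and it is the final passage of the arc `j`. -/
theorem liftAttachment_conjEnd_true (harc : α.arc none = Fin.last n)
    (hmax : ∀ x, α.arc (some x) = Fin.last n → α.before (some x) none)
    (ψ : Lift (conjStrands n) (α.comap some (Option.some_injective Λ))) (j : Fin n) :
    liftAttachment (conjStrands n) α (liftOptionEquiv α harc ((j, true), ψ)) =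
      insertLast (liftAttachment (conjStrands n) _ ψ) j := by
  have hm : ∀ x, ψ.pass x = (j, 2) → α.before (some x) none := fun x hx => hmax x (by
    rw [← (conjStrands_src_eq_last (j, (2 : Fin 3))).2 (by simp), ← hx]
    exact (ψ.src_pass x).symm)
  ext x y
  · rcases x with _ | x <;> rfl
  · rcases x with _ | x <;> rcases y with _ | y
    · exact iff_of_false (Attachment.irrefl _ _) (Attachment.irrefl _ _)
    · refine iff_of_false ?_ fun h => h.2 trivial
      rintro (h | ⟨h, h'⟩)
      · exact absurd h.2 (not_lt.2 (Fin.le_last _))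
      · exact α.asymm (hm y h.symm) h'
    · constructor
      · intro h
        exact ⟨Attachment.arc_eq _ h, trivial⟩
      · rintro ⟨h, -⟩
        by_cases h2 : (ψ.pass x).2 = 2
        · have : ψ.pass x = (j, 2) := Prod.ext h h2
          exact Or.inr ⟨this, by
            change if (conjStrands n).pos (ψ.pass x) then _ else _
            rw [this]
            exact hm x this⟩
        · exact Or.inl ⟨h, lt_of_le_of_ne (Fin.le_last _) h2⟩
    · exact Iff.rfl

/-- The passage 0 is negative, so the last leg `none` becomes the first one on it, and it is the
initial passage of the arc `j`. -/
theorem liftAttachment_conjEnd_false (harc : α.arc none = Fin.last n)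
    (hmax : ∀ x, α.arc (some x) = Fin.last n → α.before (some x) none)
    (ψ : Lift (conjStrands n) (α.comap some (Option.some_injective Λ))) (j : Fin n) :
    liftAttachment (conjStrands n) α (liftOptionEquiv α harc ((j, false), ψ)) =
      insertFirst (liftAttachment (conjStrands n) _ ψ) j := by
  have hm : ∀ x, ψ.pass x = (j, 0) → α.before (some x) none := fun x hx => hmax x (by
    rw [← (conjStrands_src_eq_last (j, (0 : Fin 3))).2 (by simp), ← hx]
    exact (ψ.src_pass x).symm)
  ext x y
  · rcases x with _ | x <;> rfl
  · rcases x with _ | x <;> rcases y with _ | y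
    · exact iff_of_false (Attachment.irrefl _ _) (Attachment.irrefl _ _)
    · constructor
      · intro h
        exact ⟨(Attachment.arc_eq _ h).symm, id⟩
      · rintro ⟨h, -⟩
        by_cases h2 : (ψ.pass y).2 = 0
        · have : ψ.pass y = (j, 0) := Prod.ext h h2
          exact Or.inr ⟨this.symm, hm y this⟩
        · exact Or.inl ⟨h.symm, Fin.pos_of_ne_zero h2⟩
    · refine iff_of_false ?_ fun h => h.2
      rintro (h | ⟨h, h'⟩)
      · exact absurd h.2 (Fin.not_lt_zero _)
      · replace h : ψ.pass x = (j, 0) := h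
        change if (conjStrands n).pos (ψ.pass x) then _ else _ at h'
        rw [h] at h'
        exact α.asymm (hm x h) h'
    · exact Iff.rfl

/-- A leg on the last arc makes the cabling with `conjStrands` vanish. -/
theorem cable_conjStrands_option (K : Type u) [Field K] [Fintype Λ] {σ : Option Λ → Option Λ}
    (hσ : Function.Involutive σ) (hne : ∀ x, σ x ≠ x) (harc : α.arc none = Fin.last n)
    (hmax : ∀ x, α.arc (some x) = Fin.last n → α.before (some x) none) :
    cable K (conjStrands n) ⟨chordGraph σ hσ hne, α⟩ = 0 := by
  have hsum : cable K (conjStrands n) ⟨chordGraph σ hσ hne, α⟩ =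
      ∑ φ : Lift (conjStrands n) α, liftSign K (conjStrands n) α φ •
        mk K ⟨chordGraph σ hσ hne, liftAttachment (conjStrands n) α φ⟩ := rfl
  have hs : ∀ (j : Fin n) (b : Bool) ψ, liftSign K (conjStrands n) α (liftOptionEquiv α harc ((j, b), ψ)) =
      (if b then 1 else -1) * liftSign K (conjStrands n) _ ψ := by
    intro j b ψ
    rw [liftSign, Fintype.prod_option]
    congr 1
    cases b <;> rfl
  -- For a fixed position `ψ` of the other legs, the sum over the end passages for `none` is a
  -- signed difference of the two sides of `sum_insertFirst_eq`.
  rw [hsum, ← Equiv.sum_comp (liftOptionEquiv α harc), Fintype.sum_prod_type_right]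
  refine Finset.sum_eq_zero fun ψ _ => ?_
  rw [Fintype.sum_prod_type]
  simp only [Fintype.sum_bool, hs, liftAttachment_conjEnd_true α harc hmax,
    liftAttachment_conjEnd_false α harc hmax, if_true, Bool.false_eq_true, if_false, one_mul,
    neg_one_mul, neg_smul, ← sub_eq_add_neg, ← smul_sub]
  rw [← Finset.smul_sum, Finset.sum_sub_distrib, sum_insertFirst_eq, sub_self, smul_zero]

end Option

/-- Relabelling the legs so that the last one on the last arc is called `none` reduces this to
`cable_conjStrands_option`. -/
theorem cable_conjStrands_of_arc_eq_last (K : Type u) [Field K] {n : ℕ} {Λ : Type} [Fintype Λ]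
    {σ : Λ → Λ} (hσ : Function.Involutive σ) (hne : ∀ x, σ x ≠ x) (α : Attachment (n + 1) Λ)
    {x₀ : Λ} (hx₀ : α.arc x₀ = Fin.last n) :
    cable K (conjStrands n) ⟨chordGraph σ hσ hne, α⟩ = 0 := by
  classical
  obtain ⟨l, hl, hmax⟩ := exists_extremal α true {x | α.arc x = Fin.last n} ⟨x₀, hx₀⟩
    fun x hx y hy => Eq.trans hx (Eq.symm hy)
  let e := Equiv.optionSubtypeNe l
  have hσ' : Function.Involutive (e.symm ∘ σ ∘ e) := fun x => by simp [hσ _]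
  have hne' : ∀ x, (e.symm ∘ σ ∘ e) x ≠ x := fun x h =>
    hne (e x) (e.symm.injective (by simpa using h))
  have h := mk_chordGraph_congr K (hσ := hσ') (hne := hne') (hσ' := hσ) (hne' := hne) e
    (fun x => by simp) (α := α.comap e e.injective) (α' := α) (fun _ => rfl) fun _ _ => Iff.rfl
  rw [← cableMap_mk, ← h, cableMap_mk]
  refine cable_conjStrands_option _ K hσ' hne' ?_ fun x hx => ?_
  · simpa [Attachment.comap, e] using hl
  · have := hmax x.1 hx x.2
    simpa [Attachment.comap, e] using this

/-- No leg can be moved to a passage along `y`, and the middle passages alone form the strands of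
the inclusion. -/
theorem cable_conjStrands_of_arc_ne_last (K : Type u) [Field K] {n : ℕ} (D : JacobiDiagram (n + 1))
    (hD : ∀ x, D.att.arc x ≠ Fin.last n) :
    cable K (conjStrands n) D = cable K (inclStrands n) D := by
  have h1 : ∀ (φ : Lift (conjStrands n) D.att) x, (φ.pass x).2 = 1 := by
    intro φ x
    by_contra h
    exact hD x (by rw [← φ.src_pass, (conjStrands_src_eq_last _).2 h])
  let e : Lift (conjStrands n) D.att ≃ Lift (inclStrands n) D.att :=
    { toFun := fun φ => ⟨fun x => (φ.pass x).1, fun x => by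
        rw [← φ.src_pass]
        change _ = if (φ.pass x).2 = 1 then _ else _
        rw [if_pos (h1 φ x)]
        rfl⟩
      invFun := fun φ => ⟨fun x => (φ.pass x, 1), fun x => φ.src_pass x⟩
      left_inv := fun φ => Lift.ext (funext fun x => Prod.ext rfl (h1 φ x).symm)
      right_inv := fun φ => rfl }
  refine Fintype.sum_equiv e.symm.symm _ _ fun φ => ?_
  -- Writing the lift as `e.symm φ` makes its passages literally `(φ.pass x, 1)`, so signs and
  -- positions can be compared by computation.
  obtain ⟨φ, rfl⟩ := e.symm.surjective φ
  rw [Equiv.symm_symm, Equiv.apply_symm_apply]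
  refine congrArg₂ (· • ·) (Finset.prod_congr rfl fun _ _ => rfl)
    (congrArg (mk K) (congrArg (JacobiDiagram.mk D.graph) ?_))
  ext x y
  · rfl
  · change ((φ.pass x = φ.pass y ∧ (1 : Fin 3) < 1) ∨
      ((φ.pass x, (1 : Fin 3)) = (φ.pass y, 1) ∧ D.att.before x y)) ↔
      (False ∨ (φ.pass x = φ.pass y ∧ D.att.before x y))
    simp

/-- It suffices to compare chord diagrams. Those with a leg on the last arc are killed by both maps,
on the right because no strand of the inclusion runs through the last handle. -/
theorem cableMap_conjStrands (K : Type u) [Field K] (n : ℕ) :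
    cableMap K (conjStrands n) = cableMap K (inclStrands n) := by
  refine hom_ext_chord K fun Λ _ σ hσ hne α => ?_
  rw [cableMap_mk, cableMap_mk]
  by_cases h : ∃ x, α.arc x = Fin.last n
  · obtain ⟨x, hx⟩ := h
    rw [cable_conjStrands_of_arc_eq_last K hσ hne α hx, cable]
    refine (Finset.sum_eq_zero fun φ _ => ?_).symm
    exact absurd ((φ.src_pass x).trans hx) (Fin.castSucc_ne_last _)
  · exact cable_conjStrands_of_arc_ne_last K _ (not_exists.1 h)

/-- The homomorphism `x_j ↦ y x_j y⁻¹`, where `y` is the last generator of `F_{n+1}`. -/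
def conjHom (n : ℕ) : FreeGroup (Fin n) →* FreeGroup (Fin (n + 1)) :=
  FreeGroup.lift fun j => FreeGroup.of (Fin.last n) * FreeGroup.of j.castSucc *
    (FreeGroup.of (Fin.last n))⁻¹

/-- The inclusion `F_n → F_{n+1}`. -/
def inclHom (n : ℕ) : FreeGroup (Fin n) →* FreeGroup (Fin (n + 1)) :=
  FreeGroup.lift fun j => FreeGroup.of j.castSucc

/-- Homotopy invariance: a homomorphism may be cabled along any strands whose words represent the
images of the generators, whether or not the words are reduced. -/
theorem Realizes.cableMap_strandsOfHom (K : Type u) [Field K] {m n : ℕ} {P : Strands m n}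
    {w : Fin n → List (Fin m × Bool)} (h : Realizes P w)
    (f : FreeGroup (Fin n) →* FreeGroup (Fin m))
    (hf : ∀ j, FreeGroup.mk (w j) = f (FreeGroup.of j)) :
    cableMap K (strandsOfHom f) = cableMap K P := by
  rw [h.cableMap_eq K, strandsOfHom]
  exact cableMap_congr K fun j => by rw [FreeGroup.mk_toWord, hf]

theorem cableMap_conjHom (K : Type u) [Field K] (n : ℕ) :
    cableMap K (strandsOfHom (conjHom n)) = cableMap K (strandsOfHom (inclHom n)) := by
  have h1 : Realizes (conjStrands n)
      fun j => [(Fin.last n, true), (j.castSucc, true), (Fin.last n, false)] := by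
    have hmem : ∀ (j : Fin n) (o : Fin n × Fin 3), o ∈ [(j, 2), (j, 1), (j, 0)] ↔ o.1 = j := by
      rintro j ⟨k, i⟩
      fin_cases i <;> simp
    -- `Realizes` lists the passages from the last to the first, hence the decreasing order.
    refine ⟨fun j => [(j, 2), (j, 1), (j, 0)], hmem, fun j => ?_, fun j => rfl⟩
    simp [conjStrands]
  have h2 : Realizes (inclStrands n) fun j => [(j.castSucc, true)] :=
    ⟨fun j => [j], fun j o => List.mem_singleton, fun j => List.pairwise_singleton _ _,
      fun j => rfl⟩
  rw [h1.cableMap_strandsOfHom K _ fun j => ?_, h2.cableMap_strandsOfHom K _ fun j => ?_,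
    cableMap_conjStrands]
  · simp [inclHom, FreeGroup.of]
  · rw [conjHom, FreeGroup.lift_apply_of]
    rfl

/-! ## Inner automorphisms act trivially -/

/-- The substitution `y = a`, which is the homomorphism `q`, turns `conjHom` into conjugation by `a`
and `inclHom` into the identity. Their induced maps already agree before the substitution. -/
theorem cableMap_conj (K : Type u) [Field K] {n : ℕ} (a : FreeGroup (Fin n)) :
    cableMap K (strandsOfHom (MulAut.conj a).toMonoidHom) = LinearMap.id := by
  let q : FreeGroup (Fin (n + 1)) →* FreeGroup (Fin n) :=
    FreeGroup.lift (Fin.snoc (α := fun _ => FreeGroup (Fin n)) FreeGroup.of a)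
  have h1 : (MulAut.conj a).toMonoidHom = q.comp (conjHom n) :=
    FreeGroup.ext_hom _ _ fun j => by simp [q, conjHom]
  have h2 : MonoidHom.id (FreeGroup (Fin n)) = q.comp (inclHom n) :=
    FreeGroup.ext_hom _ _ fun j => by simp [q, inclHom]
  rw [h1, cableMap_hom_comp, cableMap_conjHom, ← cableMap_hom_comp, ← h2, cableMap_id]

theorem jacobiFunctor_map_inner (K : Type u) [Field K] (d n : ℕ) {g : MulAut (FreeGroup (Fin n))}
    (hg : g ∈ Inn (FreeGroup (Fin n))) :
    (jacobiFunctor K d).map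
      (Quiver.Hom.op (X := (⟨n⟩ : FreeGrp)) (Y := ⟨n⟩) g.toMonoidHom) = 𝟙 _ := by
  obtain ⟨a, rfl⟩ := hg
  refine FiltVect.Hom.ext (LinearMap.ext fun x => Subtype.ext ?_)
  exact LinearMap.congr_fun (cableMap_conj K a) x.1

theorem autAction_inner (K : Type u) [Field K] (d n : ℕ) {g : MulAut (FreeGroup (Fin n))}
    (hg : g ∈ Inn (FreeGroup (Fin n))) : autAction K d n (MulOpposite.op g) = 1 :=
  jacobiFunctor_map_inner K d n hg

/-! ### The action of the outer automorphism group -/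

/-- The right action of `Out(F_n)` on the filtered vector space `A_d(n)`. -/
noncomputable def outAction (K : Type u) [Field K] (d n : ℕ) :
    (Out (FreeGroup (Fin n)))ᵐᵒᵖ →* End (jacobiFiltVect K d n) :=
  -- The right action is rewritten as a homomorphism from the group itself to the opposite
  -- endomorphism monoid, so that it can be factored through the quotient by the inner
  -- automorphisms.
  let f : MulAut (FreeGroup (Fin n)) →* (End (jacobiFiltVect K d n))ᵐᵒᵖ :=
    { toFun := fun g => MulOpposite.op (autAction K d n (MulOpposite.op g))
      map_one' := by rw [MulOpposite.op_one, map_one, MulOpposite.op_one]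
      map_mul' := fun g h => by rw [MulOpposite.op_mul, map_mul, MulOpposite.op_mul] }
  let f' : Out (FreeGroup (Fin n)) →* (End (jacobiFiltVect K d n))ᵐᵒᵖ :=
    QuotientGroup.lift (Inn (FreeGroup (Fin n))) f fun _ hg =>
      congrArg MulOpposite.op (autAction_inner K d n hg)
  { toFun := fun q => (f' q.unop).unop
    map_one' := by rw [MulOpposite.unop_one, map_one, MulOpposite.unop_one]
    map_mul' := fun q r => by rw [MulOpposite.unop_mul, map_mul, MulOpposite.unop_mul] }

end Jacobi

theorem mainTheorem7 (K : Type u) [Field K] [CharZero K] (d : ℕ) :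
    (∀ (n : ℕ) (g : MulAut (FreeGroup (Fin n))), g ∈ Jacobi.Inn (FreeGroup (Fin n)) →
      ∀ x : (Jacobi.jacobiFiltVect K d n).carrier,
        (Jacobi.autAction K d n (MulOpposite.op g)).toLin x = x) ∧
    (∀ n : ℕ, ∃! ρ : (Jacobi.Out (FreeGroup (Fin n)))ᵐᵒᵖ →* End (Jacobi.jacobiFiltVect K d n),
      ∀ g : MulAut (FreeGroup (Fin n)),
        ρ (MulOpposite.op (QuotientGroup.mk g)) = Jacobi.autAction K d n (MulOpposite.op g)) ∧
    Jacobi.IsOuterFunctor (Jacobi.jacobiFunctor K d ⋙ Jacobi.FiltVect.forget K) := by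
  refine ⟨fun n g hg x => ?_, fun n => ⟨Jacobi.outAction K d n, fun g => ?_, fun ρ hρ => ?_⟩,
    fun n g hg => ?_⟩
  · rw [Jacobi.autAction_inner K d n hg]
    rfl
  · rfl
  -- Uniqueness: every element of `Out(F_n)` is the class of an automorphism, where the value of `ρ`
  -- is prescribed.
  · refine MonoidHom.ext fun q => ?_
    obtain ⟨q⟩ := q
    induction q using QuotientGroup.induction_on with
    | H g => exact hρ g
  · rw [Functor.comp_map, Jacobi.jacobiFunctor_map_inner K d n hg]
    rfl
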